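/- Let $A$ be a unital simple $C^*$-algebra with a unique normalized trace $\tau$ (a positive linear functional $\tau$ with $\tau(1)=1$ and $\tau(ab)=\tau(ba)$). Write $\tau\otimes\mathrm{Tr}$ for the functional $(a_{ij})\mapsto\sum_i\tau(a_{ii})$ on $M_n(A)$, and assume that $\tau$ separates equivalence classes of projections: if $p,q\in M_n(A)$ are projections with $(\tau\otimes\mathrm{Tr})(p)=(\tau\otimes\mathrm{Tr})(q)$, then $p$ and $q$ are Murray-von Neumann equivalent in $M_n(A)$. Let $\mathrm{Out}(A)$ be the group of $*$-automorphisms of $A$ modulo the inner automorphisms $\mathrm{Ad}\,u$, $u\in A$ unitary. An $A$-$A$-equivalence bimodule is an $A$-$A$-bimodule $\mathcal E$ that is a full left Hilbert $A$-module and a full right Hilbert $A$-module with ${}_A\langle\xi,\eta\rangle\zeta=\xi\langle\eta,\zeta\rangle_A$; let $\mathrm{Pic}(A)$ be the group of isomorphism classes of $A$-$A$-equivalence bimodules under $[\mathcal E_1][\mathcal E_2]=[\mathcal E_1\otimes_A\mathcal E_2]$. Let $\rho_A:\mathrm{Out}(A)\to\mathrm{Pic}(A)$ be the homomorphism $[\alpha]\mapsto[\mathcal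 E_\alpha]$, where $\mathcal E_\alpha=A$ with left multiplication, ${}_A\langle\xi,\eta\rangle=\xi\eta^*$, right action $\xi\cdot a=\xi\alpha(a)$ and $\langle\xi,\eta\rangle_A=\alpha^{-1}(\xi^*\eta)$. Let $T:\mathrm{Pic}(A)\to\mathbb R_+^\times$ be the homomorphism $T([\mathcal E])=\sum_{i=1}^n\tau(\langle\xi_i,\xi_i\rangle_A)$, where $\{\xi_i\}_{i=1}^n$ is any finite basis of $\mathcal E$, that is, $\eta=\sum_i\xi_i\langle\xi_i,\eta\rangle_A$ for all $\eta\in\mathcal E$. Let $$\mathcal F(A)=\{(\tau\otimes\mathrm{Tr})(p)\in\mathbb R_+^\times : n\in\mathbb N,\ p\in M_n(A)\text{ a projection with } pM_n(A)p\cong A\}.$$ Then $\mathcal F(A)$ is a subgroup of $\mathbb R_+^\times$ and the sequence $$1\longrightarrow\mathrm{Out}(A)\xrightarrow{\ \rho_A\ }\mathrm{Pic}(A)\xrightarrow{\ T\ }\mathcal F(A)\longrightarrow 1$$ is exact: $\rho_A$ is injective, $\mathrm{Im}\,\rho_A=\mathrm{Ker}\,T$, and $\mathrm{Im}\,T=\mathcal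 F(A)$. -/

import Mathlib

open scoped RightActions TensorProduct ComplexOrder

universe u

/-- Working notion, used only in proofs: the form `g` is additive and linear over `act` in the second
variable, and hermitian. The left inner product of a bimodule is an example for the action
`x ↦ star a • x`. -/
structure IsPreInner {A E : Type u} [CStarAlgebra A] [AddCommGroup E] (g : E → E → A)
    (act : E → A → E) : Prop where
  add_right : ∀ x y z, g x (y + z) = g x y + g x z
  act_right : ∀ x y a, g x (act y a) = g x y * a
  star_form : ∀ x y, star (g x y) = g y x
  act_zero : ∀ x, act x 0 = 0

/-- Completeness of an additive group with respect to the distance `N (x - y)`: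
every Cauchy sequence converges. -/
def IsCompleteFor {E : Type u} [AddCommGroup E] (N : E → ℝ) : Prop :=
  ∀ v : ℕ → E, (∀ ε > 0, ∃ n₀, ∀ m ≥ n₀, ∀ n ≥ n₀, N (v m - v n) < ε) →
    ∃ x, ∀ ε > 0, ∃ n₀, ∀ n ≥ n₀, N (v n - x) < ε

namespace IsPreInner

section additive

variable {A E : Type u} [CStarAlgebra A] [AddCommGroup E] {g : E → E → A} {act : E → A → E}

/-- The form as an additive map in the second variable. -/
def hom (h : IsPreInner g act) (x : E) : E →+ A := AddMonoidHom.mk' (g x) (h.add_right x)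

theorem sub_right (h : IsPreInner g act) (x y z : E) : g x (y - z) = g x y - g x z :=
  map_sub (h.hom x) y z

theorem sum_right (h : IsPreInner g act) {ι : Type*} (s : Finset ι) (x : E) (y : ι → E) :
    g x (∑ i ∈ s, y i) = ∑ i ∈ s, g x (y i) :=
  map_sum (h.hom x) y s

theorem sub_left (h : IsPreInner g act) (x y z : E) : g (x - y) z = g x z - g y z := by
  rw [← h.star_form z, h.sub_right, star_sub, h.star_form, h.star_form]

theorem add_left (h : IsPreInner g act) (x y z : E) : g (x + y) z = g x z + g y z := by
  rw [← h.star_form z, h.add_right, star_add, h.star_form, h.star_form]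

theorem act_left (h : IsPreInner g act) (x y : E) (a : A) :
    g (act x a) y = star a * g x y := by
  rw [← h.star_form y, h.act_right, star_mul, h.star_form]

theorem parseval (h : IsPreInner g act) {ι : Type*} [Fintype ι] {f : ι → E}
    (hf : ∀ x, x = ∑ i, act (f i) (g (f i) x)) (x y : E) :
    g x y = ∑ i, star (g (f i) x) * g (f i) y := by
  conv_lhs => rw [hf y]
  rw [h.sum_right]
  simp only [h.act_right, h.star_form]

end additive

variable {A E : Type u} [CStarAlgebra A] [PartialOrder A] [StarOrderedRing A] [AddCommGroup E]
  {g : E → E → A} {act : E → A → E}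

theorem nonneg_of_frame (h : IsPreInner g act) {ι : Type*} [Fintype ι] {f : ι → E}
    (hf : ∀ x, x = ∑ i, act (f i) (g (f i) x)) (x : E) : 0 ≤ g x x := by
  rw [h.parseval hf]
  exact Finset.sum_nonneg fun i _ => star_mul_self_nonneg _

theorem definite_of_frame (h : IsPreInner g act) {ι : Type*} [Fintype ι] {f : ι → E}
    (hf : ∀ x, x = ∑ i, act (f i) (g (f i) x)) (x : E) (hx : g x x = 0) : x = 0 := by
  rw [h.parseval hf, Finset.sum_eq_zero_iff_of_nonneg fun i _ => star_mul_self_nonneg _] at hx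
  have key : ∀ i, g (f i) x = 0 := fun i =>
    (CStarRing.star_mul_self_eq_zero_iff _).1 (hx i (Finset.mem_univ i))
  rw [hf x]
  simp [key, h.act_zero]

theorem norm_sq_le (h : IsPreInner g act) {ι : Type*} [Fintype ι] {f : ι → E}
    (hf : ∀ x, x = ∑ i, act (f i) (g (f i) x)) (i : ι) (x : E) :
    ‖g (f i) x‖ ≤ √‖g x x‖ := by
  apply Real.le_sqrt_of_sq_le
  rw [sq, ← CStarRing.norm_star_mul_self]
  apply CStarAlgebra.norm_le_norm_of_nonneg_of_le (star_mul_self_nonneg _)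
  rw [h.parseval hf x x]
  exact Finset.single_le_sum (f := fun i => star (g (f i) x) * g (f i) x)
    (fun i _ => star_mul_self_nonneg _) (Finset.mem_univ i)

theorem complete_of_frame (h : IsPreInner g act) {ι : Type*} [Fintype ι] {f : ι → E}
    (hf : ∀ x, x = ∑ i, act (f i) (g (f i) x)) : IsCompleteFor fun x => √‖g x x‖ := by
  intro v hv
  have hc : ∀ i, ∃ c, Filter.Tendsto (fun n => g (f i) (v n)) Filter.atTop (nhds c) := by
    intro i
    apply cauchySeq_tendsto_of_complete
    rw [Metric.cauchySeq_iff]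
    intro ε hε
    obtain ⟨n₀, hn₀⟩ := hv ε hε
    refine ⟨n₀, fun m hm n hn => ?_⟩
    rw [dist_eq_norm, ← h.sub_right]
    exact (h.norm_sq_le hf i _).trans_lt (hn₀ m hm n hn)
  choose c hc using hc
  set x := ∑ i, act (f i) (c i) with hx
  have ht : ∀ l, Filter.Tendsto (fun n => g (f l) (v n - x)) Filter.atTop (nhds 0) := by
    intro l
    have h1 : ∀ n, g (f l) (v n - x) =
        ∑ i, g (f l) (f i) * g (f i) (v n) - ∑ i, g (f l) (f i) * c i := by
      intro n
      rw [h.sub_right]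
      congr 1
      · conv_lhs => rw [hf (v n)]
        rw [h.sum_right]
        simp only [h.act_right]
      · rw [hx, h.sum_right]
        simp only [h.act_right]
    simp only [h1]
    rw [← sub_self (∑ i, g (f l) (f i) * c i)]
    exact Filter.Tendsto.sub_const
      (tendsto_finsetSum _ fun i _ => (hc i).const_mul _) _
  have hs : Filter.Tendsto (fun n => √‖g (v n - x) (v n - x)‖) Filter.atTop (nhds 0) := by
    have h2 : Filter.Tendsto (fun n => g (v n - x) (v n - x)) Filter.atTop (nhds 0) := by
      have h3 : ∀ n, g (v n - x) (v n - x) =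
          ∑ i, star (g (f i) (v n - x)) * g (f i) (v n - x) := fun n => h.parseval hf _ _
      simp only [h3]
      have h4 := tendsto_finsetSum (f := fun (i : ι) (n : ℕ) =>
        star (g (f i) (v n - x)) * g (f i) (v n - x)) Finset.univ
        (fun i _ => ((ht i).star).mul (ht i))
      simpa using h4
    have h5 := (Real.continuous_sqrt.tendsto 0).comp (by simpa using h2.norm)
    simpa [Function.comp_def] using h5
  refine ⟨x, fun ε hε => ?_⟩
  obtain ⟨n₀, hn₀⟩ := (Metric.tendsto_atTop.1 hs) ε hε
  refine ⟨n₀, fun n hn => ?_⟩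
  have := hn₀ n hn
  rwa [Real.dist_eq, sub_zero, abs_of_nonneg (Real.sqrt_nonneg _)] at this

/-- If the values of the form span a dense subspace then finitely many vectors `ξ i` have
`∑ g (ξ i) (ξ i) = 1`. -/
theorem exists_sum_eq_one (h : IsPreInner g act) (hpos : ∀ x, 0 ≤ g x x)
    (hd : Dense (Submodule.span ℂ {a | ∃ x y, a = g x y} : Set A)) :
    ∃ (n : ℕ) (ξ : Fin n → E), ∑ i, g (ξ i) (ξ i) = 1 := by
  obtain ⟨s, hs, hs1⟩ := Metric.dense_iff.1 hd 1 (1 / 2) (by norm_num)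
  obtain ⟨n, c, w, hw⟩ := Submodule.mem_span_set'.1 hs1
  choose x y hxy using fun i => (w i).2
  set y' : Fin n → E := fun i => act (y i) (c i • 1) with hy'
  have hs2 : s = ∑ i, g (x i) (y' i) := by
    rw [← hw]
    refine Finset.sum_congr rfl fun i _ => ?_
    simp [hy', h.act_right, hxy i]
  have hle : s + star s ≤ ∑ i, (g (x i) (x i) + g (y' i) (y' i)) := by
    rw [hs2, star_sum, ← Finset.sum_add_distrib]
    refine Finset.sum_le_sum fun i _ => ?_
    have := hpos (x i - y' i)
    rw [h.sub_left, h.sub_right, h.sub_right] at this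
    rw [h.star_form, ← sub_nonneg]
    convert this using 1
    abel
  have h1 : (1 : A) ≤ s + star s := by
    have hsa : IsSelfAdjoint ((1 - s) + star (1 - s)) := IsSelfAdjoint.add_star_self _
    have hn : ‖(1 - s) + star (1 - s)‖ ≤ 1 := by
      refine (norm_add_le _ _).trans ?_
      rw [norm_star]
      rw [Metric.mem_ball, dist_comm, dist_eq_norm] at hs
      linarith
    have h2 := hsa.le_algebraMap_norm_self.trans
      (algebraMap_mono A hn : algebraMap ℝ A _ ≤ algebraMap ℝ A 1)
    rw [map_one, star_sub, star_one] at h2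
    rw [← sub_nonneg] at h2 ⊢
    convert h2 using 1
    abel
  set b := ∑ i, (g (x i) (x i) + g (y' i) (y' i)) with hb
  have hb1 : (1 : A) ≤ b := h1.trans hle
  have hbp : IsStrictlyPositive b := IsStrictlyPositive.of_le isStrictlyPositive_one hb1
  set r := b ^ (-(1 / 2) : ℝ) with hr
  have hrs : star r = r := (CFC.rpow_nonneg (a := b)).isSelfAdjoint
  refine ⟨n + n, Fin.append (fun i => act (x i) r) (fun i => act (y' i) r), ?_⟩
  rw [Fin.sum_univ_add]
  simp only [Fin.append_left, Fin.append_right, h.act_right, h.act_left, hrs]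
  rw [← Finset.sum_add_distrib]
  simp only [← add_mul, ← mul_add]
  rw [← Finset.sum_mul, ← Finset.mul_sum, ← hb]
  exact CFC.conjugate_rpow_neg_one_half b hbp

end IsPreInner

/-- An `A`-`A`-equivalence bimodule: a complex `A`-`A`-bimodule that is a full left Hilbert `A`-module
and a full right Hilbert `A`-module, with `⟪x, y⟫ₗ • z = x • ⟪y, z⟫ᵣ`. The left inner product is linear
in the first variable, the right one in the second. The right action is written `x <• a`. -/
structure EquivalenceBimodule (A : Type u) [CStarAlgebra A] [PartialOrder A]
    [StarOrderedRing A] : Type (u + 1) where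
  carrier : Type u
  [addCommGroup : AddCommGroup carrier]
  [moduleComplex : Module ℂ carrier]
  [moduleLeft : Module A carrier]
  [moduleRight : Module Aᵐᵒᵖ carrier]
  [towerLeft : IsScalarTower ℂ A carrier]
  [towerRight : IsScalarTower ℂ Aᵐᵒᵖ carrier]
  [smulComm : SMulCommClass A Aᵐᵒᵖ carrier]
  innerL : carrier → carrier → A
  innerR : carrier → carrier → A
  innerL_add_left : ∀ x y z, innerL (x + y) z = innerL x z + innerL y z
  innerL_smul_left : ∀ (a : A) x y, innerL (a • x) y = a * innerL x y
  star_innerL : ∀ x y, star (innerL x y) = innerL y x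
  innerL_self_nonneg : ∀ x, 0 ≤ innerL x x
  innerL_definite : ∀ x, innerL x x = 0 → x = 0
  innerL_complete : IsCompleteFor fun x => √‖innerL x x‖
  innerL_full : Dense (Submodule.span ℂ {a | ∃ x y, a = innerL x y} : Set A)
  innerR_add_right : ∀ x y z, innerR x (y + z) = innerR x y + innerR x z
  innerR_smul_right : ∀ x y (a : A), innerR x (y <• a) = innerR x y * a
  star_innerR : ∀ x y, star (innerR x y) = innerR y x
  innerR_self_nonneg : ∀ x, 0 ≤ innerR x x
  innerR_definite : ∀ x, innerR x x = 0 → x = 0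
  innerR_complete : IsCompleteFor fun x => √‖innerR x x‖
  innerR_full : Dense (Submodule.span ℂ {a | ∃ x y, a = innerR x y} : Set A)
  innerL_smul : ∀ x y z, innerL x y • z = x <• innerR y z

namespace EquivalenceBimodule

attribute [instance] addCommGroup moduleComplex moduleLeft moduleRight towerLeft towerRight smulComm

section basics

variable {A : Type u} [CStarAlgebra A] [PartialOrder A] [StarOrderedRing A]

instance : CoeSort (EquivalenceBimodule A) (Type u) := ⟨carrier⟩

variable (E F : EquivalenceBimodule A)

theorem preR : IsPreInner E.innerR fun x a => x <• a where
  add_right := E.innerR_add_right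
  act_right := E.innerR_smul_right
  star_form := E.star_innerR
  act_zero x := by simp

theorem preL : IsPreInner E.innerL fun x a => star a • x where
  add_right x y z := by
    rw [← E.star_innerL, E.innerL_add_left, star_add, E.star_innerL, E.star_innerL]
  act_right x y a := by
    rw [← E.star_innerL, E.innerL_smul_left, star_mul, E.star_innerL, star_star]
  star_form := E.star_innerL
  act_zero x := by simp

variable {E F}

theorem innerR_add_left (x y z : E) : E.innerR (x + y) z = E.innerR x z + E.innerR y z :=
  E.preR.add_left x y z

theorem innerL_add_right (x y z : E) : E.innerL x (y + z) = E.innerL x y + E.innerL x z :=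
  E.preL.add_right x y z

theorem innerR_act_left (x y : E) (a : A) : E.innerR (x <• a) y = star a * E.innerR x y :=
  E.preR.act_left x y a

theorem innerL_act_right (x y : E) (a : A) : E.innerL x (a • y) = E.innerL x y * star a := by
  simpa using E.preL.act_right x y (star a)

theorem complex_smul_eq_left (c : ℂ) (x : E) : c • x = (c • (1 : A)) • x := by simp

theorem complex_smul_eq_right (c : ℂ) (x : E) : c • x = x <• (c • (1 : A)) := by
  rw [MulOpposite.op_smul, smul_assoc, MulOpposite.op_one, one_smul]

theorem innerR_csmul_right (c : ℂ) (x y : E) : E.innerR x (c • y) = c • E.innerR x y := by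
  rw [complex_smul_eq_right, E.innerR_smul_right]; simp

theorem innerR_csmul_left (c : ℂ) (x y : E) : E.innerR (c • x) y = star c • E.innerR x y := by
  rw [complex_smul_eq_right, innerR_act_left]; simp

theorem innerL_csmul_left (c : ℂ) (x y : E) : E.innerL (c • x) y = c • E.innerL x y := by
  rw [complex_smul_eq_left, E.innerL_smul_left]; simp

theorem innerL_csmul_right (c : ℂ) (x y : E) : E.innerL x (c • y) = star c • E.innerL x y := by
  rw [complex_smul_eq_left, innerL_act_right]; simp

/-- The right action on an equivalence bimodule is faithful. -/
theorem eq_zero_of_right (E : EquivalenceBimodule A) (a : A) (h : ∀ x : E, x <• a = 0) : a = 0 := by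
  have hz : ∀ b ∈ (Submodule.span ℂ {a | ∃ x y, a = E.innerR x y} : Set A), b * a = 0 := by
    intro b hb
    induction hb using Submodule.span_induction with
    | mem b hb =>
      obtain ⟨x, y, rfl⟩ := hb
      rw [← E.innerR_smul_right, h]
      exact map_zero (E.preR.hom x)
    | zero => simp
    | add b c _ _ hb hc => rw [add_mul, hb, hc, add_zero]
    | smul c b _ hb => rw [smul_mul_assoc, hb, smul_zero]
  have hc : IsClosed {b : A | b * a = 0} := isClosed_eq (by fun_prop) continuous_const
  have := hc.closure_subset_iff.2 hz (E.innerR_full 1)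
  simpa using this

/-- The left action on an equivalence bimodule is faithful. -/
theorem eq_zero_of_left (E : EquivalenceBimodule A) (a : A) (h : ∀ x : E, a • x = 0) : a = 0 := by
  have hz : ∀ b ∈ (Submodule.span ℂ {a | ∃ x y, a = E.innerL x y} : Set A), a * b = 0 := by
    intro b hb
    induction hb using Submodule.span_induction with
    | mem b hb =>
      obtain ⟨x, y, rfl⟩ := hb
      rw [← E.innerL_smul_left, h, ← E.star_innerL]
      rw [show E.innerL y 0 = 0 from map_zero (E.preL.hom y), star_zero]
    | zero => simp
    | add b c _ _ hb hc => rw [mul_add, hb, hc, add_zero]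
    | smul c b _ hb => rw [mul_smul_comm, hb, smul_zero]
  have hc : IsClosed {b : A | a * b = 0} := isClosed_eq (by fun_prop) continuous_const
  have := hc.closure_subset_iff.2 hz (E.innerL_full 1)
  simpa using this

theorem innerR_smul_left (a : A) (x y : E) : E.innerR (a • x) y = E.innerR x (star a • y) := by
  rw [← sub_eq_zero]
  refine E.eq_zero_of_right _ fun z => ?_
  rw [MulOpposite.op_sub, sub_smul, ← E.innerL_smul, ← E.innerL_smul, innerL_act_right, mul_smul,
    sub_self]

theorem innerL_smul_right (a : A) (x y : E) : E.innerL (x <• a) y = E.innerL x (y <• star a) := by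
  rw [← sub_eq_zero]
  refine E.eq_zero_of_left _ fun z => ?_
  rw [sub_smul, E.innerL_smul, E.innerL_smul, innerR_act_left, star_star, MulOpposite.op_mul,
    mul_smul, sub_self]

/-- A finite basis of `E` as a right Hilbert module: `η = ∑ ξᵢ ⟨ξᵢ, η⟩` for every `η`. -/
def IsFiniteBasis (E : EquivalenceBimodule A) {n : ℕ} (ξ : Fin n → E) : Prop :=
  ∀ η : E, η = ∑ i, ξ i <• E.innerR (ξ i) η

/-- Every equivalence bimodule over a unital `C⋆`-algebra has a finite basis. -/
theorem exists_finiteBasis (E : EquivalenceBimodule A) :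
    ∃ (n : ℕ) (ξ : Fin n → E), E.IsFiniteBasis ξ := by
  obtain ⟨n, ξ, h⟩ := E.preL.exists_sum_eq_one E.innerL_self_nonneg E.innerL_full
  refine ⟨n, ξ, fun η => ?_⟩
  simp only [← E.innerL_smul]
  rw [← Finset.sum_smul, h, one_smul]

/-- The left-handed analogue of `exists_finiteBasis`. -/
theorem exists_sum_innerR (E : EquivalenceBimodule A) :
    ∃ (n : ℕ) (ζ : Fin n → E), ∑ i, E.innerR (ζ i) (ζ i) = 1 :=
  E.preR.exists_sum_eq_one E.innerR_self_nonneg E.innerR_full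

theorem eq_sum_left {n : ℕ} {ζ : Fin n → E} (h : ∑ i, E.innerR (ζ i) (ζ i) = 1) (x : E) :
    x = ∑ i, E.innerL x (ζ i) • ζ i := by
  simp only [E.innerL_smul]
  rw [← Finset.sum_smul, ← Finset.op_sum, h, MulOpposite.op_one, one_smul]

theorem sum_innerL_eq_one {n : ℕ} {ξ : Fin n → E} (h : E.IsFiniteBasis ξ) :
    ∑ i, E.innerL (ξ i) (ξ i) = 1 := by
  rw [← sub_eq_zero]
  refine E.eq_zero_of_left _ fun x => ?_
  rw [sub_smul, Finset.sum_smul, one_smul, sub_eq_zero]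
  simp only [E.innerL_smul]
  exact (h x).symm

end basics

section iso

variable {A : Type u} [CStarAlgebra A] [PartialOrder A] [StarOrderedRing A]

/-- Isomorphisms of equivalence bimodules. -/
structure Iso (E F : EquivalenceBimodule A) extends E ≃ₗ[ℂ] F where
  map_smul_left : ∀ (a : A) (x : E), toFun (a • x) = a • toFun x
  map_smul_right : ∀ (x : E) (a : A), toFun (x <• a) = toFun x <• a
  map_innerL : ∀ x y : E, F.innerL (toFun x) (toFun y) = E.innerL x y
  map_innerR : ∀ x y : E, F.innerR (toFun x) (toFun y) = E.innerR x y

/-- Two equivalence bimodules that are spanned by families with the same inner products are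
isomorphic. -/
theorem iso_of_gram {E F : EquivalenceBimodule A} {ι : Type*} (p : ι → E) (q : ι → F)
    (hp : Submodule.span ℂ (Set.range p) = ⊤) (hq : Submodule.span ℂ (Set.range q) = ⊤)
    (hL : ∀ i j, F.innerL (q i) (q j) = E.innerL (p i) (p j))
    (hR : ∀ i j, F.innerR (q i) (q j) = E.innerR (p i) (p j)) : Nonempty (Iso E F) := by
  set P := Finsupp.linearCombination ℂ p with hP
  set Q := Finsupp.linearCombination ℂ q with hQ
  have hPs : Function.Surjective P := by
    rw [← LinearMap.range_eq_top, Finsupp.range_linearCombination, hp]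
  have hQs : Function.Surjective Q := by
    rw [← LinearMap.range_eq_top, Finsupp.range_linearCombination, hq]
  have z1 : ∀ (G : EquivalenceBimodule A) (x : G), G.innerR x 0 = 0 := fun G x =>
    map_zero (G.preR.hom x)
  have z2 : ∀ (G : EquivalenceBimodule A) (x : G), G.innerR 0 x = 0 := fun G x => by
    rw [← G.star_innerR, z1, star_zero]
  have z3 : ∀ (G : EquivalenceBimodule A) (x : G), G.innerL x 0 = 0 := fun G x =>
    map_zero (G.preL.hom x)
  have z4 : ∀ (G : EquivalenceBimodule A) (x : G), G.innerL 0 x = 0 := fun G x => by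
    rw [← G.star_innerL, z3, star_zero]
  have gR : ∀ s t, F.innerR (Q s) (Q t) = E.innerR (P s) (P t) := by
    intro s t
    induction s using Finsupp.induction_linear with
    | zero => simp only [map_zero, z2]
    | add s s' h h' => simp only [map_add, innerR_add_left, h, h']
    | single i c =>
      induction t using Finsupp.induction_linear with
      | zero => simp only [map_zero, z1]
      | add t t' h h' => simp only [map_add, E.innerR_add_right, F.innerR_add_right, h, h']
      | single j d =>
        simp only [hP, hQ, Finsupp.linearCombination_single, innerR_csmul_left, innerR_csmul_right,
          hR]
  have gL : ∀ s t, F.innerL (Q s) (Q t) = E.innerL (P s) (P t) := by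
    intro s t
    induction s using Finsupp.induction_linear with
    | zero => simp only [map_zero, z4]
    | add s s' h h' => simp only [map_add, E.innerL_add_left, F.innerL_add_left, h, h']
    | single i c =>
      induction t using Finsupp.induction_linear with
      | zero => simp only [map_zero, z3]
      | add t t' h h' => simp only [map_add, innerL_add_right, h, h']
      | single j d =>
        simp only [hP, hQ, Finsupp.linearCombination_single, innerL_csmul_left, innerL_csmul_right,
          hL]
  have hker : LinearMap.ker P = LinearMap.ker Q := by
    ext s
    rw [LinearMap.mem_ker, LinearMap.mem_ker]
    constructor
    · intro h
      apply F.innerR_definite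
      rw [gR, h, z1]
    · intro h
      apply E.innerR_definite
      rw [← gR, h, z1]
  set Φ : E ≃ₗ[ℂ] F := (P.quotKerEquivOfSurjective hPs).symm ≪≫ₗ
    (Submodule.quotEquivOfEq _ _ hker) ≪≫ₗ (Q.quotKerEquivOfSurjective hQs) with hΦ
  have key : ∀ s, Φ (P s) = Q s := by
    intro s
    have : (P.quotKerEquivOfSurjective hPs).symm (P s) = Submodule.Quotient.mk s := by
      rw [LinearEquiv.symm_apply_eq]; rfl
    simp only [hΦ, LinearEquiv.trans_apply, this]
    rfl
  have iR : ∀ x y, F.innerR (Φ x) (Φ y) = E.innerR x y := by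
    intro x y
    obtain ⟨s, rfl⟩ := hPs x
    obtain ⟨t, rfl⟩ := hPs y
    rw [key, key, gR]
  have iL : ∀ x y, F.innerL (Φ x) (Φ y) = E.innerL x y := by
    intro x y
    obtain ⟨s, rfl⟩ := hPs x
    obtain ⟨t, rfl⟩ := hPs y
    rw [key, key, gL]
  refine ⟨{ Φ with map_smul_left := ?_, map_smul_right := ?_, map_innerL := iL, map_innerR := iR }⟩
  · intro a x
    change Φ (a • x) = a • Φ x
    rw [← sub_eq_zero]
    apply F.innerL_definite
    rw [F.preL.sub_left]
    have : ∀ z : F, F.innerL (Φ (a • x)) z = F.innerL (a • Φ x) z := by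
      intro z
      obtain ⟨w, rfl⟩ := Φ.surjective z
      rw [iL, F.innerL_smul_left, iL, E.innerL_smul_left]
    rw [this, sub_self]
  · intro x a
    change Φ (x <• a) = Φ x <• a
    rw [← sub_eq_zero]
    apply F.innerR_definite
    rw [F.preR.sub_right]
    have : ∀ z : F, F.innerR z (Φ (x <• a)) = F.innerR z (Φ x <• a) := by
      intro z
      obtain ⟨w, rfl⟩ := Φ.surjective z
      rw [iR, F.innerR_smul_right, iR, E.innerR_smul_right]
    rw [this, sub_self]

theorem Iso.nonempty_symm {E F : EquivalenceBimodule A} (e : Iso E F) : Nonempty (Iso F E) :=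
  iso_of_gram (fun x : E => e.toFun x) (fun x : E => x)
    (by rw [(show Function.Surjective fun x : E => e.toFun x from e.toLinearEquiv.surjective).range_eq,
      Submodule.span_univ])
    (by rw [Set.range_id', Submodule.span_univ])
    (fun x y => (e.map_innerL x y).symm) (fun x y => (e.map_innerR x y).symm)

instance setoid (A : Type u) [CStarAlgebra A] [PartialOrder A] [StarOrderedRing A] :
    Setoid (EquivalenceBimodule A) where
  r E F := Nonempty (Iso E F)
  iseqv :=
    { refl E := ⟨{ LinearEquiv.refl ℂ E with
        map_smul_left _ _ := rfl, map_smul_right _ _ := rfl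
        map_innerL _ _ := rfl, map_innerR _ _ := rfl }⟩
      symm := fun ⟨e⟩ => e.nonempty_symm
      trans := fun {E F G} ⟨e⟩ ⟨f⟩ => iso_of_gram (fun x : E => x) (fun x : E => f.toFun (e.toFun x))
        (by rw [Set.range_id', Submodule.span_univ])
        (by rw [(show Function.Surjective fun x : E => f.toFun (e.toFun x) from
          f.toLinearEquiv.surjective.comp e.toLinearEquiv.surjective).range_eq,
          Submodule.span_univ])
        (fun x y => by rw [f.map_innerL, e.map_innerL])
        (fun x y => by rw [f.map_innerR, e.map_innerR]) }

end iso

theorem full_of_sum_eq_one {A : Type u} [CStarAlgebra A] {T : Type u} [AddCommGroup T] {g : T → T → A} {act : T → A → T}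
    (h : IsPreInner g act) {ι : Type*} [Fintype ι] (f : ι → T) (hf : ∑ i, g (f i) (f i) = 1) :
    Dense (Submodule.span ℂ {a | ∃ x y, a = g x y} : Set A) := by
  have : Submodule.span ℂ {a | ∃ x y, a = g x y} = ⊤ := by
    rw [eq_top_iff]
    intro a _
    rw [← one_mul a, ← hf, Finset.sum_mul]
    refine Submodule.sum_mem _ fun i _ => Submodule.subset_span ⟨f i, act (f i) a, ?_⟩
    rw [h.act_right]
  rw [this]
  exact dense_univ

section tensor

variable {A : Type u} [CStarAlgebra A] [PartialOrder A] [StarOrderedRing A]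

/-- The relations `x a ⊗ y = x ⊗ a y`. -/
def balanced (E F : EquivalenceBimodule A) : Submodule ℂ (E ⊗[ℂ] F) :=
  Submodule.span ℂ {t | ∃ (x : E) (a : A) (y : F), t = (x <• a) ⊗ₜ[ℂ] y - x ⊗ₜ[ℂ] (a • y)}

/-- The underlying space of `E ⊗_A F`. Since `A` is unital and `E`, `F` have finite bases, the
algebraic tensor product over `A` is already complete. -/
abbrev TensorCarrier (E F : EquivalenceBimodule A) : Type u := (E ⊗[ℂ] F) ⧸ balanced E F

variable (E F : EquivalenceBimodule A)

/-- The elementary tensor `x ⊗ y` in `E ⊗_A F`. -/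
def tm {E F : EquivalenceBimodule A} (x : E) (y : F) : TensorCarrier E F :=
  (balanced E F).mkQ (x ⊗ₜ[ℂ] y)

variable {E F} in
theorem tm_balanced (x : E) (a : A) (y : F) : tm (x <• a) y = tm x (a • y) := by
  rw [← sub_eq_zero, tm, tm, ← map_sub]
  exact (Submodule.Quotient.mk_eq_zero _).2 (Submodule.subset_span ⟨x, a, y, rfl⟩)

variable {E F} in
theorem tm_add_left (x x' : E) (y : F) : tm (x + x') y = tm x y + tm x' y := by
  simp [tm, TensorProduct.add_tmul]

variable {E F} in
theorem tm_add_right (x : E) (y y' : F) : tm x (y + y') = tm x y + tm x y' := by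
  simp [tm, TensorProduct.tmul_add]

theorem tm_sum_left {ι : Type*} (s : Finset ι) (x : ι → E) (y : F) :
    tm (∑ i ∈ s, x i) y = ∑ i ∈ s, tm (x i) y := by
  simp [tm, TensorProduct.sum_tmul]

theorem tm_sum_right {ι : Type*} (s : Finset ι) (x : E) (y : ι → F) :
    tm x (∑ i ∈ s, y i) = ∑ i ∈ s, tm x (y i) := by
  simp [tm, TensorProduct.tmul_sum]

theorem span_tm : Submodule.span ℂ (Set.range fun z : E × F => tm z.1 z.2) = ⊤ := by
  have h : (Set.range fun z : E × F => tm z.1 z.2) =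
      (balanced E F).mkQ '' {t | ∃ (x : E) (y : F), x ⊗ₜ[ℂ] y = t} := by
    ext t
    constructor
    · rintro ⟨⟨x, y⟩, rfl⟩
      exact ⟨_, ⟨x, y, rfl⟩, rfl⟩
    · rintro ⟨_, ⟨x, y, rfl⟩, rfl⟩
      exact ⟨(x, y), rfl⟩
  rw [h, Submodule.span_image, TensorProduct.span_tmul_eq_top, Submodule.map_top,
    Submodule.range_mkQ]

variable {E F} in
theorem tm_induction {p : TensorCarrier E F → Prop} (h : ∀ x y, p (tm x y)) (h0 : p 0)
    (ha : ∀ s t, p s → p t → p (s + t)) (t : TensorCarrier E F) : p t := by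
  obtain ⟨t, rfl⟩ := (balanced E F).mkQ_surjective t
  induction t using TensorProduct.induction_on with
  | zero => simpa using h0
  | tmul x y => exact h x y
  | add s t hs ht => rw [map_add]; exact ha _ _ hs ht

/-- The endomorphism `x ⊗ y ↦ a x ⊗ y`. -/
def tensorLeft (a : A) : TensorCarrier E F →ₗ[ℂ] TensorCarrier E F :=
  (balanced E F).mapQ (balanced E F)
    (TensorProduct.map (Algebra.lsmul ℂ ℂ E a) LinearMap.id) (by
      refine Submodule.span_le.2 ?_
      rintro _ ⟨x, b, y, rfl⟩
      refine Submodule.subset_span ⟨a • x, b, y, ?_⟩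
      simp [smul_comm a])

/-- The endomorphism `x ⊗ y ↦ x ⊗ y a`. -/
def tensorRight (a : Aᵐᵒᵖ) : TensorCarrier E F →ₗ[ℂ] TensorCarrier E F :=
  (balanced E F).mapQ (balanced E F)
    (TensorProduct.map LinearMap.id (Algebra.lsmul ℂ ℂ F a)) (by
      refine Submodule.span_le.2 ?_
      rintro _ ⟨x, b, y, rfl⟩
      refine Submodule.subset_span ⟨x, b, a • y, ?_⟩
      simp [smul_comm b])

theorem tensorLeft_tm (a : A) (x : E) (y : F) : tensorLeft E F a (tm x y) = tm (a • x) y := rfl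

theorem tensorRight_tm (a : Aᵐᵒᵖ) (x : E) (y : F) :
    tensorRight E F a (tm x y) = tm x (a • y) := rfl

instance tensorModuleLeft : Module A (TensorCarrier E F) where
  smul a := tensorLeft E F a
  one_smul t := by
    change tensorLeft E F 1 t = t
    induction t using tm_induction with
    | h x y => rw [tensorLeft_tm, one_smul]
    | h0 => exact map_zero _
    | ha s t hs ht => rw [map_add, hs, ht]
  mul_smul a b t := by
    change tensorLeft E F (a * b) t = tensorLeft E F a (tensorLeft E F b t)
    induction t using tm_induction with
    | h x y => simp only [tensorLeft_tm, mul_smul]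
    | h0 => simp only [map_zero]
    | ha s t hs ht => simp only [map_add, hs, ht]
  smul_zero a := map_zero (tensorLeft E F a)
  smul_add a := map_add (tensorLeft E F a)
  zero_smul t := by
    change tensorLeft E F 0 t = 0
    induction t using tm_induction with
    | h x y => rw [tensorLeft_tm, zero_smul, tm, TensorProduct.zero_tmul, map_zero]
    | h0 => exact map_zero _
    | ha s t hs ht => rw [map_add, hs, ht, add_zero]
  add_smul a b t := by
    change tensorLeft E F (a + b) t = tensorLeft E F a t + tensorLeft E F b t
    induction t using tm_induction with
    | h x y => simp only [tensorLeft_tm, add_smul, tm_add_left]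
    | h0 => simp only [map_zero, add_zero]
    | ha s t hs ht => simp only [map_add, hs, ht]; abel

instance tensorModuleRight : Module Aᵐᵒᵖ (TensorCarrier E F) where
  smul a := tensorRight E F a
  one_smul t := by
    change tensorRight E F 1 t = t
    induction t using tm_induction with
    | h x y => rw [tensorRight_tm, one_smul]
    | h0 => exact map_zero _
    | ha s t hs ht => rw [map_add, hs, ht]
  mul_smul a b t := by
    change tensorRight E F (a * b) t = tensorRight E F a (tensorRight E F b t)
    induction t using tm_induction with
    | h x y => simp only [tensorRight_tm, mul_smul]
    | h0 => simp only [map_zero]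
    | ha s t hs ht => simp only [map_add, hs, ht]
  smul_zero a := map_zero (tensorRight E F a)
  smul_add a := map_add (tensorRight E F a)
  zero_smul t := by
    change tensorRight E F 0 t = 0
    induction t using tm_induction with
    | h x y => rw [tensorRight_tm, zero_smul, tm, TensorProduct.tmul_zero, map_zero]
    | h0 => exact map_zero _
    | ha s t hs ht => rw [map_add, hs, ht, add_zero]
  add_smul a b t := by
    change tensorRight E F (a + b) t = tensorRight E F a t + tensorRight E F b t
    induction t using tm_induction with
    | h x y => simp only [tensorRight_tm, add_smul, tm_add_right]
    | h0 => simp only [map_zero, add_zero]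
    | ha s t hs ht => simp only [map_add, hs, ht]; abel

variable {E F} in
theorem smul_tm (a : A) (x : E) (y : F) : a • tm x y = tm (a • x) y := rfl

variable {E F} in
theorem tm_smul (a : A) (x : E) (y : F) : tm x y <• a = tm x (y <• a) := rfl

instance tensorTowerLeft : IsScalarTower ℂ A (TensorCarrier E F) where
  smul_assoc c a t := by
    induction t using tm_induction with
    | h x y =>
      rw [smul_tm, smul_tm, smul_assoc, tm, tm, ← map_smul, TensorProduct.smul_tmul']
    | h0 => simp only [smul_zero]
    | ha s t hs ht => simp only [smul_add, hs, ht]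

instance tensorTowerRight : IsScalarTower ℂ Aᵐᵒᵖ (TensorCarrier E F) where
  smul_assoc c a t := by
    induction t using tm_induction with
    | h x y =>
      change tm x ((c • a) • y) = c • tm x (a • y)
      rw [smul_assoc, tm, tm, ← map_smul, TensorProduct.tmul_smul]
    | h0 => simp only [smul_zero]
    | ha s t hs ht => simp only [smul_add, hs, ht]

instance tensorSMulComm : SMulCommClass A Aᵐᵒᵖ (TensorCarrier E F) where
  smul_comm a b t := by
    induction t using tm_induction with
    | h x y => rfl
    | h0 => simp only [smul_zero]
    | ha s t hs ht => simp only [smul_add, hs, ht]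

/-- The right inner product `⟨x ⊗ y, x' ⊗ y'⟩ = ⟨y, ⟨x, x'⟩ y'⟩` for fixed `x`, `y`. -/
noncomputable def tensorInnerRAux (x : E) (y : F) : TensorCarrier E F →ₗ[ℂ] A :=
  (balanced E F).liftQ
    (TensorProduct.lift (LinearMap.mk₂ ℂ (fun x' y' => F.innerR y (E.innerR x x' • y'))
      (fun x₁ x₂ y' => by simp only [E.innerR_add_right, add_smul, F.innerR_add_right])
      (fun c x' y' => by rw [innerR_csmul_right, smul_assoc, innerR_csmul_right])
      (fun x' y₁ y₂ => by rw [smul_add, F.innerR_add_right])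
      (fun c x' y' => by rw [smul_comm, innerR_csmul_right])))
    (by
      refine Submodule.span_le.2 ?_
      rintro _ ⟨x', a, y', rfl⟩
      simp [E.innerR_smul_right, mul_smul])

theorem tensorInnerRAux_tm (x : E) (y : F) (x' : E) (y' : F) :
    tensorInnerRAux E F x y (tm x' y') = F.innerR y (E.innerR x x' • y') := rfl

variable {E F} in
theorem tensor_hom_ext {f g : TensorCarrier E F →ₗ[ℂ] A} (h : ∀ x y, f (tm x y) = g (tm x y)) :
    f = g := by
  refine LinearMap.ext fun t => ?_
  induction t using tm_induction with
  | h x y => exact h x y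
  | h0 => simp only [map_zero]
  | ha s t hs ht => simp only [map_add, hs, ht]

/-- The right inner product of `E ⊗_A F`, determined by
`⟨x ⊗ y, x' ⊗ y'⟩ = ⟨y, ⟨x, x'⟩ y'⟩`. -/
noncomputable def tensorInnerR : TensorCarrier E F →ₗ⋆[ℂ] TensorCarrier E F →ₗ[ℂ] A :=
  (balanced E F).liftQ
    (TensorProduct.lift (LinearMap.mk₂'ₛₗ (starRingEnd ℂ) (starRingEnd ℂ) (tensorInnerRAux E F)
      (fun x₁ x₂ y => tensor_hom_ext fun x' y' => by
        simp only [LinearMap.add_apply, tensorInnerRAux_tm, innerR_add_left, add_smul,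
          F.innerR_add_right])
      (fun c x y => tensor_hom_ext fun x' y' => by
        simp only [LinearMap.smul_apply, tensorInnerRAux_tm, innerR_csmul_left, smul_assoc,
          innerR_csmul_right]
        rfl)
      (fun x y₁ y₂ => tensor_hom_ext fun x' y' => by
        simp only [LinearMap.add_apply, tensorInnerRAux_tm, innerR_add_left])
      (fun c x y => tensor_hom_ext fun x' y' => by
        simp only [LinearMap.smul_apply, tensorInnerRAux_tm, innerR_csmul_left]
        rfl)))
    (by
      refine Submodule.span_le.2 ?_
      rintro _ ⟨x, a, y, rfl⟩
      simp only [SetLike.mem_coe, LinearMap.mem_ker, map_sub, TensorProduct.lift.tmul,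
        LinearMap.mk₂'ₛₗ_apply, sub_eq_zero]
      refine tensor_hom_ext fun x' y' => ?_
      simp only [tensorInnerRAux_tm, innerR_act_left, innerR_smul_left, mul_smul])

theorem tensorInnerR_tm (x : E) (y : F) (x' : E) (y' : F) :
    tensorInnerR E F (tm x y) (tm x' y') = F.innerR y (E.innerR x x' • y') := rfl

/-- The left inner product `⟨x ⊗ y, x' ⊗ y'⟩ = ⟨x ⟨y, y'⟩, x'⟩` for fixed `x'`, `y'`. -/
noncomputable def tensorInnerLAux (x' : E) (y' : F) : TensorCarrier E F →ₗ[ℂ] A :=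
  (balanced E F).liftQ
    (TensorProduct.lift (LinearMap.mk₂ ℂ (fun x y => E.innerL (x <• F.innerL y y') x')
      (fun x₁ x₂ y => by simp only [smul_add, E.innerL_add_left])
      (fun c x y => by rw [smul_comm, innerL_csmul_left])
      (fun x y₁ y₂ => by
        simp only [F.innerL_add_left, MulOpposite.op_add, add_smul, E.innerL_add_left])
      (fun c x y => by
        rw [innerL_csmul_left, MulOpposite.op_smul, smul_assoc, innerL_csmul_left])))
    (by
      refine Submodule.span_le.2 ?_
      rintro _ ⟨x, a, y, rfl⟩
      simp [F.innerL_smul_left, mul_smul])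

theorem tensorInnerLAux_tm (x : E) (y : F) (x' : E) (y' : F) :
    tensorInnerLAux E F x' y' (tm x y) = E.innerL (x <• F.innerL y y') x' := rfl

/-- The left inner product of `E ⊗_A F` with its arguments exchanged: `tensorInnerL s t = ⟨t, s⟩`,
determined by `⟨x ⊗ y, x' ⊗ y'⟩ = ⟨x ⟨y, y'⟩, x'⟩`. -/
noncomputable def tensorInnerL : TensorCarrier E F →ₗ⋆[ℂ] TensorCarrier E F →ₗ[ℂ] A :=
  (balanced E F).liftQ
    (TensorProduct.lift (LinearMap.mk₂'ₛₗ (starRingEnd ℂ) (starRingEnd ℂ) (tensorInnerLAux E F)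
      (fun x₁ x₂ y => tensor_hom_ext fun x' y' => by
        simp only [LinearMap.add_apply, tensorInnerLAux_tm, innerL_add_right])
      (fun c x y => tensor_hom_ext fun x' y' => by
        simp only [LinearMap.smul_apply, tensorInnerLAux_tm, innerL_csmul_right]
        rfl)
      (fun x y₁ y₂ => tensor_hom_ext fun x' y' => by
        simp only [LinearMap.add_apply, tensorInnerLAux_tm, innerL_add_right, MulOpposite.op_add,
          add_smul, E.innerL_add_left])
      (fun c x y => tensor_hom_ext fun x' y' => by
        simp only [LinearMap.smul_apply, tensorInnerLAux_tm, innerL_csmul_right,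
          MulOpposite.op_smul, smul_assoc, innerL_csmul_left]
        rfl)))
    (by
      refine Submodule.span_le.2 ?_
      rintro _ ⟨x, a, y, rfl⟩
      simp only [SetLike.mem_coe, LinearMap.mem_ker, map_sub, TensorProduct.lift.tmul,
        LinearMap.mk₂'ₛₗ_apply, sub_eq_zero]
      refine tensor_hom_ext fun x' y' => ?_
      simp only [tensorInnerLAux_tm, innerL_act_right, MulOpposite.op_mul, mul_smul]
      rw [innerL_smul_right (star a), star_star])

theorem tensorInnerL_tm (x : E) (y : F) (x' : E) (y' : F) :
    tensorInnerL E F (tm x' y') (tm x y) = E.innerL (x <• F.innerL y y') x' := rfl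

theorem tensor_preR :
    IsPreInner (fun s t : TensorCarrier E F => tensorInnerR E F s t) fun t a => t <• a where
  add_right s t t' := map_add (tensorInnerR E F s) t t'
  act_right s t a := by
    induction s using tm_induction with
    | h0 => simp
    | ha s s' hs hs' => simp only [map_add, LinearMap.add_apply, hs, hs', add_mul]
    | h x y =>
      induction t using tm_induction with
      | h0 => simp
      | ha t t' ht ht' => simp only [smul_add, map_add, ht, ht', add_mul]
      | h x' y' =>
        rw [tm_smul, tensorInnerR_tm, tensorInnerR_tm, smul_comm, F.innerR_smul_right]
  star_form s t := by
    induction s using tm_induction with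
    | h0 => simp
    | ha s s' hs hs' => simp only [map_add, LinearMap.add_apply, hs, hs', star_add]
    | h x y =>
      induction t using tm_induction with
      | h0 => simp
      | ha t t' ht ht' => simp only [map_add, LinearMap.add_apply, ht, ht', star_add]
      | h x' y' =>
        rw [tensorInnerR_tm, tensorInnerR_tm, F.star_innerR, innerR_smul_left, E.star_innerR]
  act_zero t := by simp

theorem tensor_preL :
    IsPreInner (fun s t : TensorCarrier E F => tensorInnerL E F t s) fun t a => star a • t where
  add_right s t t' := by simp
  act_right s t a := by
    induction s using tm_induction with
    | h0 => simp
    | ha s s' hs hs' => simp only [map_add, hs, hs', add_mul]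
    | h x y =>
      induction t using tm_induction with
      | h0 => simp
      | ha t t' ht ht' => simp only [smul_add, map_add, LinearMap.add_apply, ht, ht', add_mul]
      | h x' y' =>
        rw [smul_tm, tensorInnerL_tm, tensorInnerL_tm, innerL_act_right, star_star]
  star_form s t := by
    induction s using tm_induction with
    | h0 => simp
    | ha s s' hs hs' => simp only [map_add, LinearMap.add_apply, hs, hs', star_add]
    | h x y =>
      induction t using tm_induction with
      | h0 => simp
      | ha t t' ht ht' => simp only [map_add, LinearMap.add_apply, ht, ht', star_add]
      | h x' y' =>
        rw [tensorInnerL_tm, tensorInnerL_tm, E.star_innerL, innerL_smul_right, F.star_innerL]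
  act_zero t := by simp

variable {E F} in
theorem tensor_innerL_smul (r s t : TensorCarrier E F) :
    tensorInnerL E F s r • t = r <• tensorInnerR E F s t := by
  induction r using tm_induction with
  | h0 => simp
  | ha r r' hr hr' => simp only [map_add, add_smul, hr, hr', smul_add]
  | h x y =>
    induction s using tm_induction with
    | h0 => simp
    | ha s s' hs hs' =>
      simp only [map_add, LinearMap.add_apply, add_smul, hs, hs', MulOpposite.op_add]
    | h x' y' =>
      induction t using tm_induction with
      | h0 => simp
      | ha t t' ht ht' => simp only [map_add, smul_add, add_smul, ht, ht', MulOpposite.op_add]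
      | h x'' y'' =>
        rw [tensorInnerL_tm, tensorInnerR_tm, smul_tm, tm_smul, E.innerL_smul, ← F.innerL_smul,
          ← tm_balanced, ← tm_balanced]

variable {E F} in
theorem tensor_basis {n m : ℕ} {ξ : Fin n → E} {η : Fin m → F} (hξ : E.IsFiniteBasis ξ)
    (hη : F.IsFiniteBasis η) (t : TensorCarrier E F) :
    t = ∑ k : Fin n × Fin m,
      tm (ξ k.1) (η k.2) <• tensorInnerR E F (tm (ξ k.1) (η k.2)) t := by
  induction t using tm_induction with
  | h0 => simp
  | ha s t hs ht =>
    simp only [map_add, MulOpposite.op_add, add_smul, Finset.sum_add_distrib]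
    rw [← hs, ← ht]
  | h x y =>
    rw [Fintype.sum_prod_type]
    simp only [tensorInnerR_tm, tm_smul]
    conv_lhs => rw [hξ x, tm_sum_left]
    refine Finset.sum_congr rfl fun i _ => ?_
    rw [tm_balanced, ← tm_sum_right, ← hη]

variable {E F} in
theorem tensor_basis_left {n m : ℕ} {ζ : Fin n → E} {ω : Fin m → F}
    (hζ : ∑ i, E.innerR (ζ i) (ζ i) = 1) (hω : ∑ i, F.innerR (ω i) (ω i) = 1)
    (t : TensorCarrier E F) :
    t = ∑ k : Fin n × Fin m,
      tensorInnerL E F (tm (ζ k.1) (ω k.2)) t • tm (ζ k.1) (ω k.2) := by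
  induction t using tm_induction with
  | h0 => simp
  | ha s t hs ht =>
    simp only [map_add, add_smul, Finset.sum_add_distrib]
    rw [← hs, ← ht]
  | h x y =>
    rw [Fintype.sum_prod_type_right]
    simp only [tensorInnerL_tm, smul_tm]
    conv_lhs => rw [eq_sum_left hω y, tm_sum_right]
    refine Finset.sum_congr rfl fun i _ => ?_
    rw [← tm_balanced, ← tm_sum_left, ← eq_sum_left hζ]

/-- The tensor product `E ⊗_A F` of equivalence bimodules. -/
noncomputable def tensor : EquivalenceBimodule A where
  carrier := TensorCarrier E F
  innerL s t := tensorInnerL E F t s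
  innerR s t := tensorInnerR E F s t
  innerL_add_left x y z := map_add _ x y
  innerL_smul_left a x y := by
    have h := (tensor_preL E F).act_left x y (star a)
    simpa using h
  star_innerL := (tensor_preL E F).star_form
  innerL_self_nonneg := by
    obtain ⟨n, ζ, hζ⟩ := E.exists_sum_innerR
    obtain ⟨m, ω, hω⟩ := F.exists_sum_innerR
    refine (tensor_preL E F).nonneg_of_frame (f := fun k : Fin n × Fin m => tm (ζ k.1) (ω k.2)) ?_
    intro t
    simpa only [(tensor_preL E F).star_form] using tensor_basis_left hζ hω t
  innerL_definite := by
    obtain ⟨n, ζ, hζ⟩ := E.exists_sum_innerR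
    obtain ⟨m, ω, hω⟩ := F.exists_sum_innerR
    refine (tensor_preL E F).definite_of_frame
      (f := fun k : Fin n × Fin m => tm (ζ k.1) (ω k.2)) ?_
    intro t
    simpa only [(tensor_preL E F).star_form] using tensor_basis_left hζ hω t
  innerL_complete := by
    obtain ⟨n, ζ, hζ⟩ := E.exists_sum_innerR
    obtain ⟨m, ω, hω⟩ := F.exists_sum_innerR
    refine (tensor_preL E F).complete_of_frame
      (f := fun k : Fin n × Fin m => tm (ζ k.1) (ω k.2)) ?_
    intro t
    simpa only [(tensor_preL E F).star_form] using tensor_basis_left hζ hω t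
  innerL_full := by
    obtain ⟨n, ξ, hξ⟩ := E.exists_finiteBasis
    obtain ⟨m, η, hη⟩ := F.exists_finiteBasis
    refine full_of_sum_eq_one (tensor_preL E F) (fun k : Fin n × Fin m => tm (ξ k.1) (η k.2)) ?_
    rw [Fintype.sum_prod_type]
    simp only [tensorInnerL_tm]
    rw [← sum_innerL_eq_one hξ]
    refine Finset.sum_congr rfl fun i _ => ?_
    have : ∀ a : A, E.innerL (ξ i <• a) (ξ i) = star (E.preL.hom (ξ i) (ξ i <• a)) := fun a =>
      (E.star_innerL _ _).symm
    simp only [this]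
    rw [← star_sum, ← map_sum, ← Finset.sum_smul, ← Finset.op_sum, sum_innerL_eq_one hη,
      MulOpposite.op_one, one_smul]
    exact E.star_innerL _ _
  innerR_add_right := (tensor_preR E F).add_right
  innerR_smul_right := (tensor_preR E F).act_right
  star_innerR := (tensor_preR E F).star_form
  innerR_self_nonneg := by
    obtain ⟨n, ξ, hξ⟩ := E.exists_finiteBasis
    obtain ⟨m, η, hη⟩ := F.exists_finiteBasis
    exact (tensor_preR E F).nonneg_of_frame (tensor_basis hξ hη)
  innerR_definite := by
    obtain ⟨n, ξ, hξ⟩ := E.exists_finiteBasis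
    obtain ⟨m, η, hη⟩ := F.exists_finiteBasis
    exact (tensor_preR E F).definite_of_frame (tensor_basis hξ hη)
  innerR_complete := by
    obtain ⟨n, ξ, hξ⟩ := E.exists_finiteBasis
    obtain ⟨m, η, hη⟩ := F.exists_finiteBasis
    exact (tensor_preR E F).complete_of_frame (tensor_basis hξ hη)
  innerR_full := by
    obtain ⟨n, ζ, hζ⟩ := E.exists_sum_innerR
    obtain ⟨m, ω, hω⟩ := F.exists_sum_innerR
    refine full_of_sum_eq_one (tensor_preR E F) (fun k : Fin n × Fin m => tm (ζ k.1) (ω k.2)) ?_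
    rw [Fintype.sum_prod_type_right]
    simp only [tensorInnerR_tm]
    rw [← hω]
    refine Finset.sum_congr rfl fun i _ => ?_
    rw [← F.preR.sum_right, ← Finset.sum_smul, hζ, one_smul]
  innerL_smul := tensor_innerL_smul

end tensor

section auto

theorem complete_of_norm {A : Type u} [CStarAlgebra A] {N : A → ℝ} (h : ∀ x, N x = ‖x‖) :
    IsCompleteFor N := by
  intro v hv
  have : CauchySeq v := by
    rw [Metric.cauchySeq_iff]
    intro ε hε
    obtain ⟨n₀, h₀⟩ := hv ε hε
    exact ⟨n₀, fun m hm n hn => by rw [dist_eq_norm, ← h]; exact h₀ m hm n hn⟩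
  obtain ⟨x, hx⟩ := cauchySeq_tendsto_of_complete this
  refine ⟨x, fun ε hε => ?_⟩
  obtain ⟨n₀, h₀⟩ := Metric.tendsto_atTop.1 hx ε hε
  exact ⟨n₀, fun n hn => by rw [h, ← dist_eq_norm]; exact h₀ n hn⟩

variable {A : Type u} [CStarAlgebra A] [PartialOrder A] [StarOrderedRing A]

/-- The right module structure `x • a = x α(a)` on `A`. -/
@[reducible]
noncomputable def twistModule (α : A ≃⋆ₐ[ℂ] A) : Module Aᵐᵒᵖ A :=
  Module.compHom A (RingHom.op (α : A →+* A))

/-- The bimodule `E_α`: the space `A` with left multiplication, `⟪x, y⟫ₗ = x y⋆`, right action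
`x • a = x α(a)`, and `⟪x, y⟫ᵣ = α⁻¹(x⋆ y)`. -/
noncomputable def twist (α : A ≃⋆ₐ[ℂ] A) : EquivalenceBimodule A :=
  letI := twistModule α
  have hs : ∀ x a : A, x <• a = x * α a := fun _ _ => rfl
  { carrier := A
    towerRight := ⟨fun c a x => show (x * α (c • a.unop) : A) = c • (x * α a.unop) by
      rw [map_smul, mul_smul_comm]⟩
    smulComm := ⟨fun a b x => show (a * (x * α b.unop) : A) = a * x * α b.unop from
      (mul_assoc _ _ _).symm⟩
    innerL x y := x * star y
    innerR x y := α.symm (star x * y)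
    innerL_add_left x y z := add_mul x y (star z)
    innerL_smul_left a x y := mul_assoc a x (star y)
    star_innerL x y := by rw [star_mul, star_star]
    innerL_self_nonneg x := mul_star_self_nonneg x
    innerL_definite x h := (CStarRing.mul_star_self_eq_zero_iff x).1 h
    innerL_complete := complete_of_norm fun x => by
      rw [CStarRing.norm_self_mul_star, Real.sqrt_mul_self (norm_nonneg x)]
    innerL_full := by
      have : Submodule.span ℂ {a : A | ∃ x y : A, a = x * star y} = ⊤ := by
        rw [eq_top_iff]
        exact fun a _ => Submodule.subset_span ⟨a, 1, by simp⟩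
      rw [this]
      exact dense_univ
    innerR_add_right x y z := by rw [mul_add, map_add]
    innerR_smul_right x y a := by
      rw [hs, ← mul_assoc, map_mul, StarAlgEquiv.symm_apply_apply]
    star_innerR x y := by rw [← map_star, star_mul, star_star]
    innerR_self_nonneg x := by
      rw [map_mul, map_star]
      exact star_mul_self_nonneg _
    innerR_definite x h := by
      rw [map_mul, map_star, CStarRing.star_mul_self_eq_zero_iff] at h
      exact (map_eq_zero_iff _ α.symm.injective).1 h
    innerR_complete := complete_of_norm fun x => by
      rw [NonUnitalStarAlgHom.norm_map α.symm α.symm.injective, CStarRing.norm_star_mul_self,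
        Real.sqrt_mul_self (norm_nonneg x)]
    innerR_full := by
      have : Submodule.span ℂ {a : A | ∃ x y : A, a = α.symm (star x * y)} = ⊤ := by
        rw [eq_top_iff]
        exact fun a _ => Submodule.subset_span ⟨1, α a, by simp⟩
      rw [this]
      exact dense_univ
    innerL_smul x y z := by
      rw [hs, StarAlgEquiv.apply_symm_apply, smul_eq_mul, mul_assoc] }

/-- An element of `A`, seen in `E_α`. -/
def toTwist (α : A ≃⋆ₐ[ℂ] A) (x : A) : twist α := x

section

variable (α : A ≃⋆ₐ[ℂ] A)

theorem toTwist_surjective : Function.Surjective (toTwist α) := fun x => ⟨x, rfl⟩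

theorem twist_innerL (x y : A) : (twist α).innerL (toTwist α x) (toTwist α y) = x * star y := rfl

theorem twist_innerR (x y : A) :
    (twist α).innerR (toTwist α x) (toTwist α y) = α.symm (star x * y) := rfl

theorem smul_toTwist (a x : A) : a • toTwist α x = toTwist α (a * x) := rfl

theorem toTwist_smul (a x : A) : toTwist α x <• a = toTwist α (x * α a) := rfl

end

/-- The identity bimodule: `A` with `⟪a, b⟫ₗ = a b⋆` and `⟪a, b⟫ᵣ = a⋆ b`. -/
noncomputable abbrev unit (A : Type u) [CStarAlgebra A] [PartialOrder A] [StarOrderedRing A] :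
    EquivalenceBimodule A :=
  twist (1 : A ≃⋆ₐ[ℂ] A)

end auto

section dual

variable {A : Type u} [CStarAlgebra A] [PartialOrder A] [StarOrderedRing A]

/-- The ring homomorphism `a ↦ a⋆` from `A` to its opposite. -/
def opStar (A : Type u) [CStarAlgebra A] : A →+* Aᵐᵒᵖ where
  toFun a := MulOpposite.op (star a)
  map_one' := by simp
  map_mul' a b := by simp
  map_zero' := by simp
  map_add' a b := by simp

/-- The ring homomorphism `a ↦ a⋆` from the opposite of `A` to `A`. -/
def unopStar (A : Type u) [CStarAlgebra A] : Aᵐᵒᵖ →+* A where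
  toFun a := star a.unop
  map_one' := by simp
  map_mul' a b := by simp
  map_zero' := by simp
  map_add' a b := by simp

theorem isScalarTower_mk {R S M : Type*} (i₁ : SMul R S) (i₂ : SMul S M) (i₃ : SMul R M)
    (h : ∀ r s m, i₂.smul (i₁.smul r s) m = i₃.smul r (i₂.smul s m)) :
    @IsScalarTower R S M i₁ i₂ i₃ := ⟨h⟩

theorem smulCommClass_mk {R S M : Type*} (i₁ : SMul R M) (i₂ : SMul S M)
    (h : ∀ r s m, i₁.smul r (i₂.smul s m) = i₂.smul s (i₁.smul r m)) :
    @SMulCommClass R S M i₁ i₂ := ⟨h⟩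

/-- `c x⋆ = (c̄ x)⋆`. -/
@[reducible]
noncomputable def dualModuleComplex (E : EquivalenceBimodule A) : Module ℂ E :=
  Module.compHom E (starRingEnd ℂ)

/-- `a x⋆ = (x a⋆)⋆`. -/
@[reducible]
noncomputable def dualModuleLeft (E : EquivalenceBimodule A) : Module A E :=
  Module.compHom E (opStar A)

/-- `x⋆ a = (a⋆ x)⋆`. -/
@[reducible]
noncomputable def dualModuleRight (E : EquivalenceBimodule A) : Module Aᵐᵒᵖ E :=
  Module.compHom E (unopStar A)

/-- The dual bimodule `{x⋆ : x ∈ E}` of `E`, with `c x⋆ = (c̄ x)⋆`, `a x⋆ b = (b⋆ x a⋆)⋆`. -/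
noncomputable def dual (E : EquivalenceBimodule A) : EquivalenceBimodule A :=
  { carrier := E
    moduleComplex := dualModuleComplex E
    moduleLeft := dualModuleLeft E
    moduleRight := dualModuleRight E
    towerLeft := isScalarTower_mk _ _ _ fun c a x => by
      change E.moduleRight.smul (MulOpposite.op (star (c • a))) x =
        E.moduleComplex.smul (star c) (E.moduleRight.smul (MulOpposite.op (star a)) x)
      rw [star_smul, MulOpposite.op_smul]
      exact E.towerRight.smul_assoc _ _ _
    towerRight := isScalarTower_mk _ _ _ fun c a x => by
      change E.moduleLeft.smul (star (c • a.unop)) x =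
        E.moduleComplex.smul (star c) (E.moduleLeft.smul (star a.unop) x)
      rw [star_smul]
      exact E.towerLeft.smul_assoc _ _ _
    smulComm := smulCommClass_mk _ _ fun a b x =>
      (E.smulComm.smul_comm (star b.unop) (MulOpposite.op (star a)) x).symm
    innerL x y := E.innerR x y
    innerR x y := E.innerL x y
    innerL_add_left x y z := innerR_add_left x y z
    innerL_smul_left a x y := (innerR_act_left x y (star a)).trans (by rw [star_star])
    star_innerL := E.star_innerR
    innerL_self_nonneg := E.innerR_self_nonneg
    innerL_definite := E.innerR_definite
    innerL_complete := E.innerR_complete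
    innerL_full := E.innerR_full
    innerR_add_right x y z := innerL_add_right x y z
    innerR_smul_right x y a := (innerL_act_right x y (star a)).trans (by rw [star_star])
    star_innerR := E.star_innerL
    innerR_self_nonneg := E.innerL_self_nonneg
    innerR_definite := E.innerL_definite
    innerR_complete := E.innerL_complete
    innerR_full := E.innerL_full
    innerL_smul x y z := by
      change E.moduleRight.smul (MulOpposite.op (star (E.innerR x y))) z =
        E.moduleLeft.smul (star (E.innerL y z)) x
      rw [E.star_innerR, E.star_innerL]
      exact (E.innerL_smul z y x).symm }

/-- The element `x⋆` of the dual bimodule. -/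
def toDual (E : EquivalenceBimodule A) (x : E) : dual E := x

section

variable (E : EquivalenceBimodule A)

theorem toDual_surjective : Function.Surjective (toDual E) := fun x => ⟨x, rfl⟩

theorem dual_innerL (x y : E) : (dual E).innerL (toDual E x) (toDual E y) = E.innerR x y := rfl

theorem dual_innerR (x y : E) : (dual E).innerR (toDual E x) (toDual E y) = E.innerL x y := rfl

theorem toDual_smul (x : E) (a : A) : toDual E x <• a = toDual E (star a • x) := rfl

end

end dual

section laws

variable {A : Type u} [CStarAlgebra A] [PartialOrder A] [StarOrderedRing A]

theorem span_of_surjective {M ι : Type*} [AddCommGroup M] [Module ℂ M] {f : ι → M}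
    (h : Function.Surjective f) : Submodule.span ℂ (Set.range f) = ⊤ := by
  rw [h.range_eq, Submodule.span_univ]

theorem span_id (E : EquivalenceBimodule A) : Submodule.span ℂ (Set.range fun x : E => x) = ⊤ :=
  span_of_surjective Function.surjective_id

/-- The elementary tensor `x ⊗ y`, as an element of the bimodule `E ⊗_A F`. -/
def tmul {E F : EquivalenceBimodule A} (x : E) (y : F) : tensor E F := tm x y

section

variable {E F : EquivalenceBimodule A}

theorem tmul_innerL (x x' : E) (y y' : F) :
    (tensor E F).innerL (tmul x y) (tmul x' y') = E.innerL (x <• F.innerL y y') x' := rfl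

theorem tmul_innerR (x x' : E) (y y' : F) :
    (tensor E F).innerR (tmul x y) (tmul x' y') = F.innerR y (E.innerR x x' • y') := rfl

theorem smul_tmul (a : A) (x : E) (y : F) : a • tmul x y = tmul (a • x) y := rfl

theorem tmul_smul (a : A) (x : E) (y : F) : tmul x y <• a = tmul x (y <• a) := rfl

/-- The elementary tensor as a bilinear map. -/
noncomputable def tmulHom (E F : EquivalenceBimodule A) : E →ₗ[ℂ] F →ₗ[ℂ] tensor E F :=
  (TensorProduct.mk ℂ E F).compr₂ (balanced E F).mkQ

theorem tmulHom_apply (x : E) (y : F) : tmulHom E F x y = tmul x y := rfl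

theorem span_tmul_univ :
    Submodule.span ℂ (Set.range fun z : E × F => tmul z.1 z.2) = ⊤ := span_tm E F

/-- Tensors of spanning families span. -/
theorem span_tmul {ι κ : Type*} (p : ι → E) (q : κ → F)
    (hp : Submodule.span ℂ (Set.range p) = ⊤) (hq : Submodule.span ℂ (Set.range q) = ⊤) :
    Submodule.span ℂ (Set.range fun k : ι × κ => tmul (p k.1) (q k.2)) = ⊤ := by
  rw [← top_le_iff, ← span_tmul_univ, Submodule.span_le]
  rintro _ ⟨⟨x, y⟩, rfl⟩
  have h := Submodule.apply_mem_map₂ (tmulHom E F) (hp ▸ Submodule.mem_top : x ∈ _)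
    (hq ▸ Submodule.mem_top : y ∈ _)
  rw [Submodule.map₂_span_span] at h
  refine Submodule.span_mono ?_ h
  rintro _ ⟨_, ⟨i, rfl⟩, _, ⟨k, rfl⟩, rfl⟩
  exact ⟨(i, k), rfl⟩

end

theorem tensor_congr {E E' F F' : EquivalenceBimodule A} (e : Iso E E') (f : Iso F F') :
    Nonempty (Iso (tensor E F) (tensor E' F')) := by
  refine iso_of_gram (E := tensor E F) (F := tensor E' F') (fun k : E × F => tmul k.1 k.2)
    (fun k : E × F => tmul (e.toFun k.1) (f.toFun k.2))
    (span_tmul (fun x : E => x) (fun y : F => y) (span_id E) (span_id F))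
    (span_tmul (fun x : E => e.toFun x) (fun x : F => f.toFun x)
      (span_of_surjective e.toLinearEquiv.surjective)
      (span_of_surjective f.toLinearEquiv.surjective)) ?_ ?_
  · rintro ⟨x, y⟩ ⟨x', y'⟩
    rw [tmul_innerL, tmul_innerL, f.map_innerL, ← e.map_smul_right, e.map_innerL]
  · rintro ⟨x, y⟩ ⟨x', y'⟩
    rw [tmul_innerR, tmul_innerR, e.map_innerR, ← f.map_smul_left, f.map_innerR]

theorem tensor_assoc (E F G : EquivalenceBimodule A) :
    Nonempty (Iso (tensor (tensor E F) G) (tensor E (tensor F G))) := by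
  refine iso_of_gram (E := tensor (tensor E F) G) (F := tensor E (tensor F G))
    (fun k : (E × F) × G => tmul (tmul k.1.1 k.1.2) k.2)
    (fun k : (E × F) × G => tmul k.1.1 (tmul k.1.2 k.2))
    (span_tmul (fun k : E × F => tmul k.1 k.2) (fun z : G => z)
      (span_tmul (fun x : E => x) (fun y : F => y) (span_id E) (span_id F)) (span_id G)) ?_ ?_ ?_
  · have h := span_tmul (fun x : E => x) (fun k : F × G => tmul k.1 k.2) (span_id E)
      (span_tmul (fun x : F => x) (fun y : G => y) (span_id F) (span_id G))
    rw [← (Equiv.prodAssoc E F G).surjective.range_comp] at h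
    exact h
  · rintro ⟨⟨x, y⟩, z⟩ ⟨⟨x', y'⟩, z'⟩
    simp only [tmul_innerL, tmul_smul]
  · rintro ⟨⟨x, y⟩, z⟩ ⟨⟨x', y'⟩, z'⟩
    simp only [tmul_innerR, smul_tmul]

theorem unit_tensor (E : EquivalenceBimodule A) : Nonempty (Iso (tensor (unit A) E) E) := by
  refine iso_of_gram (E := tensor (unit A) E) (F := E) (fun k : A × E => tmul (toTwist 1 k.1) k.2)
    (fun k : A × E => k.1 • k.2)
    (span_tmul (fun a : A => toTwist 1 a) (fun x : E => x)
      (span_of_surjective (toTwist_surjective 1)) (span_id E))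
    (span_of_surjective fun x => ⟨(1, x), one_smul A x⟩) ?_ ?_
  · rintro ⟨a, x⟩ ⟨b, y⟩
    rw [tmul_innerL, toTwist_smul, twist_innerL, innerL_act_right, E.innerL_smul_left]
    rfl
  · rintro ⟨a, x⟩ ⟨b, y⟩
    rw [tmul_innerR, twist_innerR, innerR_smul_left, ← mul_smul]
    rfl

theorem tensor_unit (E : EquivalenceBimodule A) : Nonempty (Iso (tensor E (unit A)) E) := by
  refine iso_of_gram (E := tensor E (unit A)) (F := E) (fun k : E × A => tmul k.1 (toTwist 1 k.2))
    (fun k : E × A => k.1 <• k.2)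
    (span_tmul (fun x : E => x) (fun a : A => toTwist 1 a) (span_id E)
      (span_of_surjective (toTwist_surjective 1)))
    (span_of_surjective fun x => ⟨(x, 1), by simp⟩) ?_ ?_
  · rintro ⟨x, a⟩ ⟨y, b⟩
    rw [tmul_innerL, twist_innerL, MulOpposite.op_mul, mul_smul, innerL_smul_right (star b),
      star_star]
  · rintro ⟨x, a⟩ ⟨y, b⟩
    rw [tmul_innerR, smul_toTwist, twist_innerR, innerR_act_left, E.innerR_smul_right]
    rfl

theorem dual_tensor (E : EquivalenceBimodule A) :
    Nonempty (Iso (tensor (dual E) E) (unit A)) := by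
  refine iso_of_gram (E := tensor (dual E) E) (F := unit A) (fun k : E × E => tmul (toDual E k.1) k.2)
    (fun k : E × E => toTwist 1 (E.innerR k.1 k.2))
    (span_tmul (fun x : E => toDual E x) (fun x : E => x)
      (span_of_surjective (toDual_surjective E)) (span_id E)) ?_ ?_ ?_
  · rw [eq_top_iff]
    intro a _
    obtain ⟨a, rfl⟩ := toTwist_surjective _ a
    obtain ⟨n, ζ, hζ⟩ := E.exists_sum_innerR
    have h : toTwist 1 a = ∑ i, toTwist 1 (E.innerR (ζ i) (ζ i <• a)) := by
      simp only [E.innerR_smul_right]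
      conv_lhs => rw [← one_mul a, ← hζ, Finset.sum_mul]
      rfl
    rw [h]
    exact Submodule.sum_mem _ fun i _ => Submodule.subset_span ⟨(ζ i, ζ i <• a), rfl⟩
  · rintro ⟨x, y⟩ ⟨x', y'⟩
    rw [tmul_innerL, toDual_smul, twist_innerL, dual_innerL, innerR_smul_left, star_star,
      E.innerL_smul, E.innerR_smul_right, E.star_innerR]
  · rintro ⟨x, y⟩ ⟨x', y'⟩
    rw [tmul_innerR, dual_innerR, twist_innerR, E.innerL_smul, E.innerR_smul_right, E.star_innerR]
    rfl

theorem twist_tensor (α β : A ≃⋆ₐ[ℂ] A) :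
    Nonempty (Iso (tensor (twist α) (twist β)) (twist (α * β))) := by
  refine iso_of_gram (E := tensor (twist α) (twist β)) (F := twist (α * β)) (fun k : A × A => tmul (toTwist α k.1) (toTwist β k.2))
    (fun k : A × A => toTwist (α * β) (k.1 * α k.2))
    (span_tmul (fun x : A => toTwist α x) (fun x : A => toTwist β x)
      (span_of_surjective (toTwist_surjective _))
      (span_of_surjective (toTwist_surjective _)))
    (span_of_surjective fun x => ?_) ?_ ?_
  · obtain ⟨x, rfl⟩ := toTwist_surjective _ x
    exact ⟨(x, 1), by simp⟩
  · rintro ⟨x, y⟩ ⟨x', y'⟩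
    rw [tmul_innerL, twist_innerL, twist_innerL, toTwist_smul, twist_innerL, star_mul, map_mul,
      map_star]
    simp only [mul_assoc]
  · rintro ⟨x, y⟩ ⟨x', y'⟩
    rw [tmul_innerR, twist_innerR, twist_innerR, smul_toTwist, twist_innerR]
    change β.symm (α.symm _) = _
    rw [star_mul]
    simp only [map_mul, map_star, StarAlgEquiv.symm_apply_apply, mul_assoc]

theorem twist_inner_iso (u : unitary A) :
    Nonempty (Iso (twist (Unitary.conjStarAlgAut ℂ A u)) (unit A)) := by
  refine iso_of_gram (E := twist (Unitary.conjStarAlgAut ℂ A u)) (F := unit A) (fun a : A => toTwist _ (a * star (u : A))) (fun a : A => toTwist 1 a)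
    (span_of_surjective fun a => ?_) (span_of_surjective (toTwist_surjective 1)) ?_ ?_
  · obtain ⟨a, rfl⟩ := toTwist_surjective _ a
    exact ⟨a * u, by simp [mul_assoc]⟩
  · intro a b
    rw [twist_innerL, twist_innerL, star_mul, star_star, mul_assoc, ← mul_assoc (star (u : A)),
      Unitary.coe_star_mul_self, one_mul]
  · intro a b
    rw [twist_innerR, twist_innerR, Unitary.conjStarAlgAut_symm_apply, star_mul, star_star]
    change star a * b = _
    simp only [mul_assoc, Unitary.coe_star_mul_self, mul_one]
    rw [← mul_assoc (star (u : A)), Unitary.coe_star_mul_self, one_mul]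

end laws

theorem dual_congr {A : Type u} [CStarAlgebra A] [PartialOrder A] [StarOrderedRing A]
    {E F : EquivalenceBimodule A} (e : Iso E F) : Nonempty (Iso (dual E) (dual F)) := by
  refine iso_of_gram (E := dual E) (F := dual F) (fun x : E => toDual E x)
    (fun x : E => toDual F (e.toFun x)) (span_of_surjective (toDual_surjective E))
    (span_of_surjective ((toDual_surjective F).comp e.toLinearEquiv.surjective)) ?_ ?_
  · intro x y
    rw [dual_innerL, dual_innerL, e.map_innerR]
  · intro x y
    rw [dual_innerR, dual_innerR, e.map_innerL]

end EquivalenceBimodule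

open EquivalenceBimodule in
/-- The Picard group of `A`: isomorphism classes of `A`-`A`-equivalence bimodules. -/
def Pic (A : Type u) [CStarAlgebra A] [PartialOrder A] [StarOrderedRing A] : Type (u + 1) :=
  Quotient (EquivalenceBimodule.setoid A)

namespace Pic

open EquivalenceBimodule

variable {A : Type u} [CStarAlgebra A] [PartialOrder A] [StarOrderedRing A]

/-- The class of an equivalence bimodule. -/
def mk (E : EquivalenceBimodule A) : Pic A := Quotient.mk _ E

/-- The group law is `[E][F] = [E ⊗_A F]`, the unit is `[A]`, the inverse of `[E]` is the class of
the dual of `E`. -/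
noncomputable instance : Group (Pic A) where
  mul := Quotient.map₂ tensor fun _ _ ⟨e⟩ _ _ ⟨f⟩ => tensor_congr e f
  one := mk (unit A)
  inv := Quotient.map dual fun _ _ ⟨e⟩ => dual_congr e
  mul_assoc a b c := by
    induction a using Quotient.inductionOn
    induction b using Quotient.inductionOn
    induction c using Quotient.inductionOn
    exact Quotient.sound (tensor_assoc _ _ _)
  one_mul a := by
    induction a using Quotient.inductionOn
    exact Quotient.sound (unit_tensor _)
  mul_one a := by
    induction a using Quotient.inductionOn
    exact Quotient.sound (tensor_unit _)
  inv_mul_cancel a := by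
    induction a using Quotient.inductionOn
    exact Quotient.sound (dual_tensor _)

theorem mk_mul (E F : EquivalenceBimodule A) : mk E * mk F = mk (tensor E F) := rfl

theorem mk_unit : mk (unit A) = 1 := rfl

theorem mk_surjective : Function.Surjective (mk : EquivalenceBimodule A → Pic A) :=
  Quotient.mk_surjective

theorem mk_eq {E F : EquivalenceBimodule A} : mk E = mk F ↔ Nonempty (Iso E F) := Quotient.eq

end Pic

/-! ### Outer automorphisms -/

/-- The group `Inn(A)` of the inner automorphisms `x ↦ u x u⋆`, `u` unitary. -/
def innerAut (A : Type u) [CStarAlgebra A] : Subgroup (A ≃⋆ₐ[ℂ] A) :=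
  (Unitary.conjStarAlgAut ℂ A).range

instance (A : Type u) [CStarAlgebra A] : (innerAut A).Normal where
  conj_mem := by
    rintro _ ⟨u, rfl⟩ α
    refine ⟨⟨α u, ?_⟩, ?_⟩
    · rw [Unitary.mem_iff, ← map_star, ← map_mul, ← map_mul, (Unitary.mem_iff.1 u.2).1,
        (Unitary.mem_iff.1 u.2).2, map_one]
      exact ⟨rfl, rfl⟩
    · ext x
      change α u * x * star (α u) = α (u * α.symm x * star (u : A))
      rw [map_mul, map_mul, StarAlgEquiv.apply_symm_apply, map_star]

/-- `Out(A) = Aut(A) / Inn(A)`, where `Aut(A)` consists of the `⋆`-automorphisms. -/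
abbrev Out (A : Type u) [CStarAlgebra A] : Type u := (A ≃⋆ₐ[ℂ] A) ⧸ innerAut A

open EquivalenceBimodule in
/-- The homomorphism `ρ_A : Out(A) → Pic(A)`, `[α] ↦ [E_α]`. -/
noncomputable def rho (A : Type u) [CStarAlgebra A] [PartialOrder A] [StarOrderedRing A] :
    Out A →* Pic A :=
  QuotientGroup.lift (innerAut A)
    (MonoidHom.mk' (fun α => Pic.mk (twist α)) fun α β => (Pic.mk_eq.2 (twist_tensor α β)).symm)
    (by
      rintro _ ⟨u, rfl⟩
      exact Pic.mk_eq.2 (twist_inner_iso u))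

/-! ### Traces -/

section traces

variable {A : Type u} [CStarAlgebra A] [PartialOrder A] [StarOrderedRing A]

/-- A normalized trace: a positive linear functional `τ` with `τ(1) = 1` and `τ(ab) = τ(ba)`. -/
structure IsNormalizedTrace (τ : A →ₚ[ℂ] ℂ) : Prop where
  map_one : τ 1 = 1
  mul_comm : ∀ a b, τ (a * b) = τ (b * a)

/-- `τ` is the unique normalized trace of `A`. -/
structure IsUniqueTrace (τ : A →ₚ[ℂ] ℂ) : Prop extends IsNormalizedTrace τ where
  unique : ∀ σ : A →ₚ[ℂ] ℂ, IsNormalizedTrace σ → σ = τ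

namespace EquivalenceBimodule

variable {τ : A →ₚ[ℂ] ℂ}

/-- The value `∑ τ(⟨ξᵢ, ξᵢ⟩)` does not depend on the finite basis, nor on the bimodule in its
isomorphism class. -/
theorem sum_trace_eq (hτ : IsNormalizedTrace τ) {E F : EquivalenceBimodule A} (e : Iso E F)
    {n m : ℕ} {ξ : Fin n → E} {η : Fin m → F} (hξ : E.IsFiniteBasis ξ) (hη : F.IsFiniteBasis η) :
    ∑ i, τ (E.innerR (ξ i) (ξ i)) = ∑ j, τ (F.innerR (η j) (η j)) := by
  have h1 : ∀ i, E.innerR (ξ i) (ξ i) =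
      ∑ j, star (F.innerR (η j) (e.toFun (ξ i))) * F.innerR (η j) (e.toFun (ξ i)) := by
    intro i
    rw [← e.map_innerR, F.preR.parseval hη]
  have hη' : ∀ j, ∃ x, e.toFun x = η j := fun j => e.toLinearEquiv.surjective (η j)
  choose x hx using hη'
  have h2 : ∀ j, F.innerR (η j) (η j) =
      ∑ i, F.innerR (η j) (e.toFun (ξ i)) * star (F.innerR (η j) (e.toFun (ξ i))) := by
    intro j
    rw [← hx, e.map_innerR, E.preR.parseval hξ]
    refine Finset.sum_congr rfl fun i _ => ?_
    rw [e.map_innerR, E.star_innerR, E.star_innerR]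
  simp only [h1, h2, map_sum]
  rw [Finset.sum_comm]
  simp only [hτ.mul_comm]

theorem sum_trace_nonneg (τ : A →ₚ[ℂ] ℂ) (E : EquivalenceBimodule A) {n : ℕ} (ξ : Fin n → E) :
    0 ≤ ∑ i, τ (E.innerR (ξ i) (ξ i)) :=
  Finset.sum_nonneg fun _ _ => map_nonneg τ (E.innerR_self_nonneg _)

/-- The positive functional `a ↦ ∑ τ(⟨ηⱼ, a ηⱼ⟩)`. -/
noncomputable def inducedTrace (τ : A →ₚ[ℂ] ℂ) (E : EquivalenceBimodule A) {n : ℕ}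
    (η : Fin n → E) : A →ₚ[ℂ] ℂ :=
  PositiveLinearMap.mk₀
    { toFun a := ∑ j, τ (E.innerR (η j) (a • η j))
      map_add' a b := by
        simp only [add_smul, E.innerR_add_right, map_add, Finset.sum_add_distrib]
      map_smul' c a := by
        simp only [smul_assoc, innerR_csmul_right, map_smul, Finset.smul_sum, RingHom.id_apply] }
    (by
      intro a ha
      refine Finset.sum_nonneg fun j _ => map_nonneg τ ?_
      obtain ⟨b, rfl⟩ := CStarAlgebra.nonneg_iff_eq_star_mul_self.1 ha
      rw [mul_smul, ← star_star b, ← innerR_smul_left, star_star]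
      exact E.innerR_self_nonneg _)

theorem inducedTrace_apply (τ : A →ₚ[ℂ] ℂ) (E : EquivalenceBimodule A) {n : ℕ}
    (η : Fin n → E) (a : A) : inducedTrace τ E η a = ∑ j, τ (E.innerR (η j) (a • η j)) := rfl

theorem inducedTrace_comm (hτ : IsNormalizedTrace τ) (E : EquivalenceBimodule A) {n : ℕ}
    {η : Fin n → E} (hη : E.IsFiniteBasis η) (a b : A) :
    inducedTrace τ E η (a * b) = inducedTrace τ E η (b * a) := by
  have key : ∀ a b : A, inducedTrace τ E η (a * b) =
      ∑ j, ∑ i, τ (E.innerR (η j) (a • η i) * E.innerR (η i) (b • η j)) := by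
    intro a b
    rw [inducedTrace_apply]
    refine Finset.sum_congr rfl fun j _ => ?_
    rw [← map_sum, mul_smul]
    conv_lhs => rw [hη (b • η j), Finset.smul_sum]
    rw [E.preR.sum_right]
    simp only [smul_comm a, E.innerR_smul_right]
  rw [key, key, Finset.sum_comm]
  simp only [hτ.mul_comm]

/-- Since the normalized trace is unique, the induced trace is proportional to it. -/
theorem inducedTrace_eq (hτ : IsUniqueTrace τ) (E : EquivalenceBimodule A) {n : ℕ}
    {η : Fin n → E} (hη : E.IsFiniteBasis η) (a : A) :
    inducedTrace τ E η a = (∑ j, τ (E.innerR (η j) (η j))) * τ a := by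
  set c := ∑ j, τ (E.innerR (η j) (η j)) with hc
  have hc0 : 0 ≤ c := sum_trace_nonneg τ E η
  have hc1 : inducedTrace τ E η 1 = c := by simp only [inducedTrace_apply, one_smul, hc]
  have hpos : 0 < 1 + c := add_pos_of_pos_of_nonneg one_pos hc0
  have hinv : 0 ≤ (1 + c)⁻¹ := (inv_pos_of_pos hpos).le
  let σ : A →ₚ[ℂ] ℂ := PositiveLinearMap.mk₀
    ((1 + c)⁻¹ • (τ.toLinearMap + (inducedTrace τ E η).toLinearMap)) (by
      intro a ha
      exact mul_nonneg hinv
        (add_nonneg (map_nonneg τ ha) (map_nonneg (inducedTrace τ E η) ha)))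
  have hσ : ∀ a, σ a = (1 + c)⁻¹ * (τ a + inducedTrace τ E η a) := fun _ => rfl
  have hst : σ = τ := by
    refine hτ.unique σ ⟨?_, fun a b => ?_⟩
    · rw [hσ, hτ.map_one, hc1, inv_mul_cancel₀ hpos.ne']
    · rw [hσ, hσ, hτ.mul_comm, inducedTrace_comm hτ.toIsNormalizedTrace E hη]
  have h := hσ a
  rw [hst, eq_inv_mul_iff_mul_eq₀ hpos.ne', add_mul, one_mul] at h
  exact (add_left_cancel h).symm

/-- `∑ τ(⟨ξᵢ, ξᵢ⟩)` for a finite basis `ξ` of `E`. -/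
noncomputable def traceValue (τ : A →ₚ[ℂ] ℂ) (E : EquivalenceBimodule A) : ℂ :=
  ∑ i, τ (E.innerR (E.exists_finiteBasis.choose_spec.choose i)
    (E.exists_finiteBasis.choose_spec.choose i))

theorem traceValue_eq (hτ : IsNormalizedTrace τ) (E : EquivalenceBimodule A) {n : ℕ}
    {ξ : Fin n → E} (hξ : E.IsFiniteBasis ξ) :
    traceValue τ E = ∑ i, τ (E.innerR (ξ i) (ξ i)) :=
  sum_trace_eq hτ (Quotient.exact (rfl : Pic.mk E = Pic.mk E)).some
    E.exists_finiteBasis.choose_spec.choose_spec hξ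

theorem traceValue_congr (hτ : IsNormalizedTrace τ) {E F : EquivalenceBimodule A} (e : Iso E F) :
    traceValue τ E = traceValue τ F :=
  sum_trace_eq hτ e E.exists_finiteBasis.choose_spec.choose_spec
    F.exists_finiteBasis.choose_spec.choose_spec

theorem traceValue_nonneg (τ : A →ₚ[ℂ] ℂ) (E : EquivalenceBimodule A) : 0 ≤ traceValue τ E :=
  sum_trace_nonneg τ E _

theorem traceValue_unit (hτ : IsNormalizedTrace τ) : traceValue τ (unit A) = 1 := by
  have h : (unit A).IsFiniteBasis fun _ : Fin 1 => toTwist 1 (1 : A) := by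
    intro η
    obtain ⟨a, rfl⟩ := toTwist_surjective _ η
    rw [Fin.sum_univ_one, twist_innerR, toTwist_smul, star_one, one_mul, one_mul]
    rfl
  rw [traceValue_eq hτ _ h, Fin.sum_univ_one, twist_innerR, star_one, one_mul, map_one,
    hτ.map_one]

theorem traceValue_tensor (hτ : IsUniqueTrace τ) (E F : EquivalenceBimodule A) :
    traceValue τ (tensor E F) = traceValue τ E * traceValue τ F := by
  obtain ⟨n, ξ, hξ⟩ := E.exists_finiteBasis
  obtain ⟨m, η, hη⟩ := F.exists_finiteBasis
  have h : (tensor E F).IsFiniteBasis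
      fun k : Fin (n * m) => tmul (ξ (finProdFinEquiv.symm k).1) (η (finProdFinEquiv.symm k).2) := by
    intro t
    rw [finProdFinEquiv.symm.sum_comp
      fun k : Fin n × Fin m => tmul (ξ k.1) (η k.2) <• (tensor E F).innerR (tmul (ξ k.1) (η k.2)) t]
    exact tensor_basis hξ hη t
  rw [traceValue_eq hτ.toIsNormalizedTrace _ h, traceValue_eq hτ.toIsNormalizedTrace _ hξ,
    traceValue_eq hτ.toIsNormalizedTrace _ hη,
    finProdFinEquiv.symm.sum_comp fun k : Fin n × Fin m =>
      τ ((tensor E F).innerR (tmul (ξ k.1) (η k.2)) (tmul (ξ k.1) (η k.2))),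
    Fintype.sum_prod_type, Finset.sum_mul]
  refine Finset.sum_congr rfl fun i _ => ?_
  rw [mul_comm, ← inducedTrace_eq hτ F hη, inducedTrace_apply]
  rfl

end EquivalenceBimodule

open EquivalenceBimodule in
/-- The map `T` with complex values, `T([E]) = ∑ τ(⟨ξᵢ, ξᵢ⟩)`, as a homomorphism. -/
noncomputable def traceHomComplex (τ : A →ₚ[ℂ] ℂ) (hτ : IsUniqueTrace τ) : Pic A →* ℂ where
  toFun := Quotient.lift (traceValue τ) fun _ _ ⟨e⟩ => traceValue_congr hτ.toIsNormalizedTrace e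
  map_one' := traceValue_unit hτ.toIsNormalizedTrace
  map_mul' a b := by
    induction a using Quotient.inductionOn
    induction b using Quotient.inductionOn
    exact traceValue_tensor hτ _ _

theorem traceHomComplex_pos (τ : A →ₚ[ℂ] ℂ) (hτ : IsUniqueTrace τ) (a : Pic A) :
    0 < traceHomComplex τ hτ a := by
  have h : traceHomComplex τ hτ a * traceHomComplex τ hτ a⁻¹ = 1 := by
    rw [← map_mul, mul_inv_cancel, map_one]
  refine lt_of_le_of_ne ?_ (left_ne_zero_of_mul_eq_one h).symm
  induction a using Quotient.inductionOn
  exact EquivalenceBimodule.traceValue_nonneg τ _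

/-- The homomorphism `T : Pic(A) → ℝ₊ˣ`, `T([E]) = ∑ τ(⟨ξᵢ, ξᵢ⟩)` for any finite basis `ξ` of `E`
(see `traceHom_mk`). -/
noncomputable def traceHom (τ : A →ₚ[ℂ] ℂ) (hτ : IsUniqueTrace τ) : Pic A →* {t : ℝ // 0 < t} where
  toFun a := ⟨(traceHomComplex τ hτ a).re, (Complex.pos_iff.1 (traceHomComplex_pos τ hτ a)).1⟩
  map_one' := by
    ext
    change (traceHomComplex τ hτ 1).re = 1
    rw [map_one, Complex.one_re]
  map_mul' a b := by
    ext
    change (traceHomComplex τ hτ (a * b)).re =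
      (traceHomComplex τ hτ a).re * (traceHomComplex τ hτ b).re
    rw [map_mul, Complex.mul_re, ← (Complex.pos_iff.1 (traceHomComplex_pos τ hτ a)).2, zero_mul,
      sub_zero]

theorem traceHom_mk (τ : A →ₚ[ℂ] ℂ) (hτ : IsUniqueTrace τ) (E : EquivalenceBimodule A) {n : ℕ}
    {ξ : Fin n → E} (hξ : E.IsFiniteBasis ξ) :
    ((traceHom τ hτ (Pic.mk E) : ℝ) : ℂ) = ∑ i, τ (E.innerR (ξ i) (ξ i)) := by
  rw [← EquivalenceBimodule.traceValue_eq hτ.toIsNormalizedTrace E hξ]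
  have h := (Complex.pos_iff.1 (traceHomComplex_pos τ hτ (Pic.mk E))).2
  exact Complex.ext rfl h

end traces

/-! ### The fundamental group -/

/-- The `⋆`-algebra `p Mₙ(A) p = {x : p x = x = x p}` for a projection `p` of `Mₙ(A)`. -/
def cornerAlgebra {A : Type u} [CStarAlgebra A] {n : ℕ} (p : Matrix (Fin n) (Fin n) A)
    (hp : IsStarProjection p) : NonUnitalStarSubalgebra ℂ (Matrix (Fin n) (Fin n) A) where
  carrier := {x | p * x = x ∧ x * p = x}
  zero_mem' := by simp
  add_mem' := by
    rintro x y ⟨h1, h2⟩ ⟨h3, h4⟩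
    exact ⟨by rw [mul_add, h1, h3], by rw [add_mul, h2, h4]⟩
  mul_mem' := by
    rintro x y ⟨h1, h2⟩ ⟨h3, h4⟩
    exact ⟨by rw [← mul_assoc, h1], by rw [mul_assoc, h4]⟩
  smul_mem' := by
    rintro c x ⟨h1, h2⟩
    exact ⟨by rw [mul_smul_comm, h1], by rw [smul_mul_assoc, h2]⟩
  star_mem' := by
    rintro x ⟨h1, h2⟩
    have h : star p = p := hp.isSelfAdjoint
    exact ⟨by rw [← h, ← star_mul, h2], by rw [← h, ← star_mul, h1]⟩

section fundamental

variable {A : Type u} [CStarAlgebra A] [PartialOrder A] [StarOrderedRing A]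

/-- The fundamental group `F(A)`: the numbers `(τ ⊗ Tr)(p)` for the projections `p` of the matrix
algebras `Mₙ(A)` with `p Mₙ(A) p ≅ A`. Here `(τ ⊗ Tr)(p) = ∑ τ(pᵢᵢ)`. -/
def fundamentalGroup (τ : A →ₚ[ℂ] ℂ) : Set {t : ℝ // 0 < t} :=
  {t | ∃ (n : ℕ) (p : Matrix (Fin n) (Fin n) A) (hp : IsStarProjection p),
    Nonempty (A ≃⋆ₐ[ℂ] cornerAlgebra p hp) ∧ ∑ i, τ (p i i) = ((t : ℝ) : ℂ)}

/-- The trace separates equivalence classes of projections: projections of `Mₙ(A)` with the same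
trace are Murray-von Neumann equivalent. -/
def SeparatesProjections (τ : A →ₚ[ℂ] ℂ) : Prop :=
  ∀ (n : ℕ) (p q : Matrix (Fin n) (Fin n) A), IsStarProjection p → IsStarProjection q →
    ∑ i, τ (p i i) = ∑ i, τ (q i i) → ∃ w : Matrix (Fin n) (Fin n) A, star w * w = p ∧ w * star w = q

/-- `A` is a simple `C⋆`-algebra: it is non-zero and its only closed two-sided ideals are `0`
and `A`. -/
structure IsSimpleCStarAlgebra (A : Type u) [CStarAlgebra A] : Prop where
  nontrivial : Nontrivial A
  eq_bot_or_eq_top : ∀ I : TwoSidedIdeal A, IsClosed (I : Set A) → I = ⊥ ∨ I = ⊤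

end fundamental

/-!
The three parts of the exactness are independent.

*Injectivity of `ρ`.* An isomorphism `E_α ≅ A` sends `1` to some `u ∈ A`. Comparing the two inner
products of `1` with itself shows that `u` is unitary, and comparing the two actions on `1` gives
`u a = α(a) u` (`mem_innerAut_of_iso`).

*`Im ρ = Ker T`.* The vector `1` is a basis of `E_α` with trace `1`. Conversely, let `ξ` be a finite
basis of `E`. Its Gram matrix is a projection of trace `T([E])`; if this is `1`, then by separation
it is equivalent to the first coordinate projection, through a partial isometry `w` whose only
non-zero row `w₀` gives a vector `η = ∑ ξᵢ w₀ᵢ⋆` with `⟪η, η⟫ₗ = 1 = ⟪η, η⟫ᵣ`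
(`IsFiniteBasis.exists_unit_vector`). Such a vector generates `E` freely from both sides, so
`η a = α(a) η` defines an automorphism `α` with `E ≅ E_α` (`twist_vectorAut_iso`).

*`Im T = F(A)`.* If `p` is the Gram matrix of a finite basis of `E`, then `a ↦ (⟪ξᵢ, a ξⱼ⟫ᵣ)` is an
isomorphism from `A` onto the corner `p Mₙ(A) p` (`cornerHom`). Conversely, an isomorphism
`φ : A ≅ p Mₙ(A) p` makes `p Aⁿ` an equivalence bimodule (`ofCorner`), for which the columns of `p`
form a finite basis with Gram matrix `p`. Simplicity of `A` makes its right inner product full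
(`columns_full`); fullness also gives finitely many `ζᵢ` with `∑ ⟪ζᵢ, ζᵢ⟫ᵣ = 1`, from which
positivity and completeness of the left inner product follow.
-/

namespace EquivalenceBimodule

/-! ### Vectors with `⟪η, η⟫ₗ = 1 = ⟪η, η⟫ᵣ` -/

section unitVector

variable {A : Type u} [CStarAlgebra A] [PartialOrder A] [StarOrderedRing A]
  {E : EquivalenceBimodule A} {η : E}

theorem innerL_act_smul_self (hR : E.innerR η η = 1) (a : A) :
    E.innerL (η <• a) η • η = η <• a := by
  rw [E.innerL_smul, hR, MulOpposite.op_one, one_smul]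

theorem act_innerR_self (hL : E.innerL η η = 1) (x : E) : η <• E.innerR η x = x := by
  rw [← E.innerL_smul, hL, one_smul]

/-- If `⟪η, η⟫ₗ = 1 = ⟪η, η⟫ᵣ` then every `η <• a` is `α(a) • η` for a unique `α(a)`, and `α` is a
`⋆`-automorphism. -/
def vectorAut (hL : E.innerL η η = 1) (hR : E.innerR η η = 1) : A ≃⋆ₐ[ℂ] A where
  toFun a := E.innerL (η <• a) η
  invFun a := E.innerR η (a • η)
  left_inv a := by
    change E.innerR η (E.innerL (η <• a) η • η) = a
    rw [innerL_act_smul_self hR, E.innerR_smul_right, hR, one_mul]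
  right_inv a := by
    change E.innerL (η <• E.innerR η (a • η)) η = a
    rw [act_innerR_self hL, E.innerL_smul_left, hL, mul_one]
  map_mul' a b := by
    rw [← E.innerL_smul_left, smul_comm, innerL_act_smul_self hR, MulOpposite.op_mul, mul_smul]
  map_add' a b := by rw [MulOpposite.op_add, add_smul, E.innerL_add_left]
  map_star' a := by rw [E.star_innerL, innerL_smul_right, star_star]
  map_smul' c a := by
    rw [MulOpposite.op_smul, smul_assoc, innerL_csmul_left]

theorem vectorAut_symm_apply (hL : E.innerL η η = 1) (hR : E.innerR η η = 1) (a : A) :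
    (vectorAut hL hR).symm a = E.innerR η (a • η) := rfl

theorem twist_vectorAut_iso (hL : E.innerL η η = 1) (hR : E.innerR η η = 1) :
    Nonempty (Iso (twist (vectorAut hL hR)) E) := by
  refine iso_of_gram (E := twist (vectorAut hL hR)) (F := E) (fun a : A => toTwist _ a)
    (fun a : A => a • η) (span_of_surjective (toTwist_surjective _))
    (span_of_surjective fun x => ⟨E.innerL x η, ?_⟩) ?_ ?_
  · rw [E.innerL_smul, hR, MulOpposite.op_one, one_smul]
  · intro a b
    rw [twist_innerL, innerL_act_right, E.innerL_smul_left, hL, mul_one]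
  · intro a b
    rw [twist_innerR, vectorAut_symm_apply, innerR_smul_left, mul_smul]

end unitVector

/-! ### Gram matrices of finite bases -/

section gram

variable {A : Type u} [CStarAlgebra A] [PartialOrder A] [StarOrderedRing A]
  {E : EquivalenceBimodule A} {n : ℕ} {ξ : Fin n → E}

theorem IsFiniteBasis.sum_innerR_mul (hξ : E.IsFiniteBasis ξ) (x y : E) :
    ∑ k, E.innerR x (ξ k) * E.innerR (ξ k) y = E.innerR x y := by
  simp only [E.preR.parseval hξ x y, E.star_innerR]

theorem IsFiniteBasis.ext_innerR (hξ : E.IsFiniteBasis ξ) {x y : E}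
    (h : ∀ i, E.innerR (ξ i) x = E.innerR (ξ i) y) : x = y := by
  rw [hξ x, hξ y]
  simp only [h]

/-- The Gram matrix of a family in `E`. -/
def gram (ξ : Fin n → E) : Matrix (Fin n) (Fin n) A := .of fun i j => E.innerR (ξ i) (ξ j)

theorem gram_apply (ξ : Fin n → E) (i j : Fin n) : gram ξ i j = E.innerR (ξ i) (ξ j) := rfl

theorem IsFiniteBasis.isStarProjection_gram (hξ : E.IsFiniteBasis ξ) :
    IsStarProjection (gram ξ) where
  isIdempotentElem := by
    ext i j
    simp only [Matrix.mul_apply, gram_apply, hξ.sum_innerR_mul]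
  isSelfAdjoint := by
    ext i j
    rw [Matrix.star_apply, gram_apply, gram_apply, E.star_innerR]

/-- If the Gram matrix of a finite basis is equivalent to a rank one coordinate projection, then the
entries of the partial isometry combine the basis into a single vector with both inner products
equal to `1`. -/
theorem IsFiniteBasis.exists_unit_vector (hξ : E.IsFiniteBasis ξ) {w : Fin n → A}
    (hw : ∀ i j, star (w i) * w j = E.innerR (ξ i) (ξ j)) (hw1 : ∑ i, w i * star (w i) = 1) :
    ∃ η : E, E.innerL η η = 1 ∧ E.innerR η η = 1 := by
  set η : E := ∑ i, ξ i <• star (w i) with hη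
  have h1 : ∀ i, E.innerR (ξ i) η = star (w i) := by
    intro i
    rw [hη, E.preR.sum_right]
    simp only [E.innerR_smul_right, ← hw, mul_assoc]
    rw [← Finset.mul_sum, hw1, mul_one]
  have h2 : ∀ x, E.innerR η x = ∑ i, w i * E.innerR (ξ i) x := by
    intro x
    rw [← hξ.sum_innerR_mul]
    refine Finset.sum_congr rfl fun i _ => ?_
    rw [← E.star_innerR, h1, star_star]
  refine ⟨η, ?_, ?_⟩
  · rw [← sub_eq_zero]
    refine E.eq_zero_of_left _ fun x => ?_
    rw [sub_smul, one_smul, sub_eq_zero, E.innerL_smul]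
    refine hξ.ext_innerR fun j => ?_
    rw [E.innerR_smul_right, h1, h2, Finset.mul_sum]
    simp only [← mul_assoc, hw, hξ.sum_innerR_mul]
  · rw [h2]
    simp only [h1, hw1]

end gram

end EquivalenceBimodule

/-! ### The kernel and the image of `ρ` -/

section exactness

open EquivalenceBimodule

variable {A : Type u} [CStarAlgebra A] [PartialOrder A] [StarOrderedRing A]

/-- An isomorphism `E_α ≅ A` maps `1` to a unitary implementing `α`. -/
theorem mem_innerAut_of_iso {α : A ≃⋆ₐ[ℂ] A} (e : Iso (twist α) (unit A)) : α ∈ innerAut A := by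
  obtain ⟨u, hu⟩ := toTwist_surjective 1 (e.toFun (toTwist α 1))
  have hl := e.map_innerL (toTwist α 1) (toTwist α 1)
  have hr := e.map_innerR (toTwist α 1) (toTwist α 1)
  rw [← hu, twist_innerL, twist_innerL, star_one, one_mul] at hl
  rw [← hu, twist_innerR, twist_innerR, star_one, one_mul, map_one] at hr
  replace hr : star u * u = 1 := hr
  refine ⟨⟨u, Unitary.mem_iff.2 ⟨hr, hl⟩⟩, ?_⟩
  ext a
  change u * a * star u = α a
  have h1 : e.toFun (toTwist α (α a)) = toTwist 1 (u * a) := by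
    have := e.map_smul_right (toTwist α 1) a
    rw [toTwist_smul, one_mul, ← hu, toTwist_smul] at this
    exact this
  have h2 : e.toFun (toTwist α (α a)) = toTwist 1 (α a * u) := by
    have := e.map_smul_left (α a) (toTwist α 1)
    rw [smul_toTwist, mul_one, ← hu, smul_toTwist] at this
    exact this
  have h3 : u * a = α a * u := h1.symm.trans h2
  rw [h3, mul_assoc, hl, mul_one]

theorem rho_mk (α : A ≃⋆ₐ[ℂ] A) : rho A (QuotientGroup.mk α) = Pic.mk (twist α) := rfl

theorem rho_injective : Function.Injective (rho A) := by
  rw [injective_iff_map_eq_one]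
  intro x hx
  induction x using QuotientGroup.induction_on with
  | H α =>
    rw [rho_mk, ← Pic.mk_unit, Pic.mk_eq] at hx
    exact (QuotientGroup.eq_one_iff α).2 (mem_innerAut_of_iso hx.some)

variable {τ : A →ₚ[ℂ] ℂ}

theorem traceHom_twist (hτ : IsUniqueTrace τ) (α : A ≃⋆ₐ[ℂ] A) :
    traceHom τ hτ (Pic.mk (twist α)) = 1 := by
  have h : (twist α).IsFiniteBasis fun _ : Fin 1 => toTwist α (1 : A) := by
    intro η
    obtain ⟨a, rfl⟩ := toTwist_surjective _ η
    rw [Fin.sum_univ_one, twist_innerR, toTwist_smul, star_one, one_mul, one_mul,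
      StarAlgEquiv.apply_symm_apply]
  have := traceHom_mk τ hτ _ h
  rw [Fin.sum_univ_one, twist_innerR, star_one, one_mul, map_one, hτ.map_one] at this
  exact Subtype.ext (Complex.ofReal_injective this)

theorem exists_twist_of_traceHom_eq_one (hτ : IsUniqueTrace τ) (hsep : SeparatesProjections τ)
    (E : EquivalenceBimodule A) (hE : traceHom τ hτ (Pic.mk E) = 1) :
    ∃ α : A ≃⋆ₐ[ℂ] A, Nonempty (Iso (twist α) E) := by
  obtain ⟨n, ξ, hξ⟩ := E.exists_finiteBasis
  have ht : ∑ i, τ (gram ξ i i) = 1 := by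
    have := traceHom_mk τ hτ E hξ
    rw [hE] at this
    simpa [gram_apply] using this.symm
  cases n with
  | zero => simp at ht
  | succ n =>
    have hq : IsStarProjection (Matrix.single (0 : Fin (n + 1)) (0 : Fin (n + 1)) (1 : A)) :=
      ⟨by simp [IsIdempotentElem], by simp [IsSelfAdjoint, Matrix.star_eq_conjTranspose]⟩
    have hqt : ∑ i, τ (Matrix.single (0 : Fin (n + 1)) (0 : Fin (n + 1)) (1 : A) i i) = 1 := by
      rw [Finset.sum_eq_single 0 (fun i _ hi => by simp [hi.symm]) (by simp),
        Matrix.single_apply_same, hτ.map_one]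
    obtain ⟨w, hw, hw'⟩ := hsep _ _ _ hξ.isStarProjection_gram hq (ht.trans hqt.symm)
    -- Only the first row of `w` is non-zero, since `w w⋆` is the first coordinate projection.
    have hrow : ∀ k ≠ 0, ∀ i, w k i = 0 := by
      intro k hk i
      have h := congrFun (congrFun hw' k) k
      rw [Matrix.single_apply_of_row_ne hk.symm, Matrix.mul_apply] at h
      simp only [Matrix.star_apply] at h
      rw [Finset.sum_eq_zero_iff_of_nonneg fun i _ => mul_star_self_nonneg _] at h
      exact (CStarRing.mul_star_self_eq_zero_iff _).1 (h i (Finset.mem_univ i))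
    obtain ⟨η, hL, hR⟩ := hξ.exists_unit_vector (w := w 0)
      (fun i j => by
        rw [← gram_apply, ← hw, Matrix.mul_apply, Finset.sum_eq_single 0]
        · rfl
        · intro k _ hk
          rw [hrow k hk, mul_zero]
        · simp)
      (by simpa [Matrix.mul_apply] using congrFun (congrFun hw' 0) 0)
    exact ⟨_, twist_vectorAut_iso hL hR⟩

theorem range_rho (hτ : IsUniqueTrace τ) (hsep : SeparatesProjections τ) :
    (rho A).range = (traceHom τ hτ).ker := by
  ext x
  constructor
  · rintro ⟨y, rfl⟩
    induction y using QuotientGroup.induction_on with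
    | H α => exact traceHom_twist hτ α
  · intro hx
    obtain ⟨E, rfl⟩ := Pic.mk_surjective x
    obtain ⟨α, hα⟩ := exists_twist_of_traceHom_eq_one hτ hsep E hx
    exact ⟨QuotientGroup.mk α, Pic.mk_eq.2 hα⟩

end exactness

namespace EquivalenceBimodule

/-! ### The corner of a Gram matrix -/

section gramCorner

variable {A : Type u} [CStarAlgebra A] [PartialOrder A] [StarOrderedRing A]
  {E : EquivalenceBimodule A} {n : ℕ} {ξ : Fin n → E}

/-- `a ↦ (⟪ξᵢ, a ξⱼ⟫ᵣ)`, the matrix of left multiplication by `a` in the finite basis `ξ`. -/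
def cornerHom (hξ : E.IsFiniteBasis ξ) :
    A →⋆ₙₐ[ℂ] cornerAlgebra (gram ξ) hξ.isStarProjection_gram where
  toFun a := ⟨.of fun i j => E.innerR (ξ i) (a • ξ j), by
    constructor
    · ext i j
      simp only [Matrix.mul_apply, gram_apply, Matrix.of_apply, hξ.sum_innerR_mul]
    · ext i j
      simp only [Matrix.mul_apply, gram_apply, Matrix.of_apply]
      rw [← star_star a]
      simp only [← innerR_smul_left (star a), hξ.sum_innerR_mul]⟩
  map_smul' c a := Subtype.ext <| by
    ext i j
    change E.innerR (ξ i) ((c • a) • ξ j) = c • E.innerR (ξ i) (a • ξ j)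
    rw [smul_assoc, innerR_csmul_right]
  map_zero' := Subtype.ext <| by
    ext i j
    change E.innerR (ξ i) ((0 : A) • ξ j) = 0
    rw [zero_smul]
    exact map_zero (E.preR.hom _)
  map_add' a b := Subtype.ext <| by
    ext i j
    change E.innerR (ξ i) ((a + b) • ξ j) = E.innerR (ξ i) (a • ξ j) + E.innerR (ξ i) (b • ξ j)
    rw [add_smul, E.innerR_add_right]
  map_mul' a b := Subtype.ext <| by
    ext i j
    change E.innerR (ξ i) ((a * b) • ξ j) =
      ∑ k, E.innerR (ξ i) (a • ξ k) * E.innerR (ξ k) (b • ξ j)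
    rw [← star_star a]
    simp only [mul_smul, ← innerR_smul_left (star a), hξ.sum_innerR_mul]
  map_star' a := Subtype.ext <| by
    ext i j
    change E.innerR (ξ i) (star a • ξ j) = star (E.innerR (ξ j) (a • ξ i))
    rw [E.star_innerR, innerR_smul_left]

theorem cornerHom_apply (hξ : E.IsFiniteBasis ξ) (a : A) (i j : Fin n) :
    (cornerHom hξ a : Matrix (Fin n) (Fin n) A) i j = E.innerR (ξ i) (a • ξ j) := rfl

theorem cornerHom_injective (hξ : E.IsFiniteBasis ξ) : Function.Injective (cornerHom hξ) := by
  rw [injective_iff_map_eq_zero]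
  intro a ha
  have h : ∀ j, a • ξ j = 0 := by
    intro j
    refine hξ.ext_innerR fun i => ?_
    rw [← cornerHom_apply hξ, ha]
    exact (map_zero (E.preR.hom _)).symm
  refine E.eq_zero_of_left a fun x => ?_
  rw [hξ x, Finset.smul_sum]
  simp only [smul_comm a, h, smul_zero, Finset.sum_const_zero]

theorem cornerHom_surjective (hξ : E.IsFiniteBasis ξ) : Function.Surjective (cornerHom hξ) := by
  rintro ⟨x, hpx, hxp⟩
  have h : ∀ j, (∑ k, ∑ l, E.innerL (ξ k <• x k l) (ξ l)) • ξ j = ∑ k, ξ k <• x k j := by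
    intro j
    rw [Finset.sum_smul]
    refine Finset.sum_congr rfl fun k _ => ?_
    rw [Finset.sum_smul]
    conv_rhs => rw [← hxp, Matrix.mul_apply, Finset.op_sum, Finset.sum_smul]
    refine Finset.sum_congr rfl fun l _ => ?_
    rw [E.innerL_smul, MulOpposite.op_mul, mul_smul, gram_apply]
  refine ⟨∑ k, ∑ l, E.innerL (ξ k <• x k l) (ξ l), Subtype.ext ?_⟩
  ext i j
  rw [cornerHom_apply, h, E.preR.sum_right]
  simp only [E.innerR_smul_right]
  exact congrFun (congrFun hpx i) j

end gramCorner

/-! ### The bimodule of a corner -/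

section columns

open Matrix

variable {A : Type u} [CStarAlgebra A] {n : ℕ} {p : Matrix (Fin n) (Fin n) A}

/-- The space `p Aⁿ` of the columns fixed by `p`. -/
def columnSpace (p : Matrix (Fin n) (Fin n) A) : Submodule ℂ (Fin n → A) where
  carrier := {v | p *ᵥ v = v}
  zero_mem' := mulVec_zero p
  add_mem' {v w} hv hw := by
    change p *ᵥ (v + w) = v + w
    rw [mulVec_add, show p *ᵥ v = v from hv, show p *ᵥ w = w from hw]
  smul_mem' c v hv := by
    change p *ᵥ (c • v) = c • v
    rw [mulVec_smul, show p *ᵥ v = v from hv]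

theorem mulVec_coe (v : columnSpace p) : p *ᵥ (v : Fin n → A) = v := v.2

theorem vecMul_star_coe (hp : IsStarProjection p) (v : columnSpace p) :
    star (v : Fin n → A) ᵥ* p = star (v : Fin n → A) := by
  have h : pᴴ = p := hp.isSelfAdjoint
  have h' := star_mulVec p (v : Fin n → A)
  rw [h, mulVec_coe] at h'
  exact h'.symm

/-- The entrywise right action of `A` on `p Aⁿ`. -/
instance columnModuleRight : Module Aᵐᵒᵖ (columnSpace p) where
  smul a v := ⟨a • (v : Fin n → A), by
    change p *ᵥ (a • (v : Fin n → A)) = _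
    rw [mulVec_smul, mulVec_coe]⟩
  one_smul v := Subtype.ext (one_smul _ _)
  mul_smul a b v := Subtype.ext (mul_smul _ _ _)
  smul_zero a := Subtype.ext (smul_zero _)
  smul_add a v w := Subtype.ext (smul_add _ _ _)
  add_smul a b v := Subtype.ext (add_smul _ _ _)
  zero_smul v := Subtype.ext (zero_smul _ _)

/-- The column `p eᵢ`. -/
def projColumn (hp : IsStarProjection p) (i : Fin n) : columnSpace p :=
  ⟨p.col i, by
    change p *ᵥ p.col i = p.col i
    rw [← mulVec_single_one, mulVec_mulVec, hp.isIdempotentElem]⟩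

theorem star_projColumn_dotProduct (hp : IsStarProjection p) (i : Fin n) (v : columnSpace p) :
    star (projColumn hp i : Fin n → A) ⬝ᵥ (v : Fin n → A) = (v : Fin n → A) i := by
  have h : star (projColumn hp i : Fin n → A) = p i := by
    ext j
    exact congrFun (congrFun hp.isSelfAdjoint i) j
  rw [h]
  exact congrFun (mulVec_coe v) i

theorem projColumn_frame (hp : IsStarProjection p) (v : columnSpace p) :
    v = ∑ i, projColumn hp i <• (star (projColumn hp i : Fin n → A) ⬝ᵥ (v : Fin n → A)) := by
  refine Subtype.ext ?_
  simp only [star_projColumn_dotProduct]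
  rw [AddSubmonoidClass.coe_finsetSum]
  ext j
  conv_lhs => rw [← mulVec_coe v]
  rw [Finset.sum_apply]
  rfl

theorem columns_preR : IsPreInner (E := columnSpace p)
    (fun v w => star (v : Fin n → A) ⬝ᵥ (w : Fin n → A)) fun v a => v <• a where
  add_right x y z := dotProduct_add _ _ _
  act_right x y a := dotProduct_smul (MulOpposite.op a) _ _
  star_form x y := by
    rw [← star_dotProduct_star, star_star]
  act_zero x := by simp

/-- The matrix `v w⋆` for two columns of `p Aⁿ`, as an element of the corner of `p`. -/
def outer (hp : IsStarProjection p) (v w : columnSpace p) : cornerAlgebra p hp :=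
  ⟨vecMulVec (v : Fin n → A) (star (w : Fin n → A)), by
    constructor
    · rw [mul_vecMulVec, mulVec_coe]
    · rw [vecMulVec_mul, vecMul_star_coe hp]⟩

theorem coe_outer (hp : IsStarProjection p) (v w : columnSpace p) :
    (outer hp v w : Matrix (Fin n) (Fin n) A) =
      vecMulVec (v : Fin n → A) (star (w : Fin n → A)) := rfl

theorem sum_outer_projColumn (hp : IsStarProjection p) :
    ((∑ i, outer hp (projColumn hp i) (projColumn hp i) : cornerAlgebra p hp) :
      Matrix (Fin n) (Fin n) A) = p := by
  have h : p * star p = p := by rw [hp.isSelfAdjoint.star_eq, hp.isIdempotentElem.eq]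
  rw [AddSubmonoidClass.coe_finsetSum]
  ext i j
  rw [Matrix.sum_apply]
  exact congrFun (congrFun h i) j

/-- The values of the right inner product of `p Aⁿ` span a two-sided ideal. By simplicity it is
dense unless `p = 0`. -/
theorem columns_full (hA : IsSimpleCStarAlgebra A) (hp : IsStarProjection p) (h0 : p ≠ 0) :
    Dense (Submodule.span ℂ {a | ∃ x y : columnSpace p,
      a = star (x : Fin n → A) ⬝ᵥ (y : Fin n → A)} : Set A) := by
  set S := Submodule.span ℂ {a | ∃ x y : columnSpace p,
    a = star (x : Fin n → A) ⬝ᵥ (y : Fin n → A)} with hS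
  have hl : ∀ c, ∀ a ∈ S, c * a ∈ S := by
    intro c a ha
    induction ha using Submodule.span_induction with
    | mem a ha =>
      obtain ⟨x, y, rfl⟩ := ha
      refine Submodule.subset_span ⟨x <• star c, y, ?_⟩
      rw [columns_preR.act_left, star_star]
    | zero => simp
    | add a b _ _ ha hb => rw [mul_add]; exact S.add_mem ha hb
    | smul d a _ ha => rw [mul_smul_comm]; exact S.smul_mem d ha
  have hr : ∀ c, ∀ a ∈ S, a * c ∈ S := by
    intro c a ha
    induction ha using Submodule.span_induction with
    | mem a ha =>
      obtain ⟨x, y, rfl⟩ := ha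
      exact Submodule.subset_span ⟨x, y <• c, (columns_preR.act_right x y c).symm⟩
    | zero => simp
    | add a b _ _ ha hb => rw [add_mul]; exact S.add_mem ha hb
    | smul d a _ ha => rw [smul_mul_assoc]; exact S.smul_mem d ha
  let I : TwoSidedIdeal A := TwoSidedIdeal.mk' (S.topologicalClosure : Set A)
    (zero_mem _) (fun h h' => add_mem h h') (fun h => neg_mem h)
    (fun {x y} hy => map_mem_closure (f := (x * ·)) (by fun_prop) hy fun a ha => hl x a ha)
    (fun {x y} hx => map_mem_closure (f := (· * y)) (by fun_prop) hx fun a ha => hr y a ha)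
  have hI : (I : Set A) = closure S := TwoSidedIdeal.coe_mk' _ _ _ _ _ _
  rcases hA.eq_bot_or_eq_top I (hI ▸ isClosed_closure) with h | h
  · refine absurd ?_ h0
    ext i j
    have hm : star (projColumn hp i : Fin n → A) ⬝ᵥ (projColumn hp j : Fin n → A) ∈ (I : Set A) :=
      hI ▸ subset_closure (Submodule.subset_span ⟨_, _, rfl⟩)
    rw [h, star_projColumn_dotProduct] at hm
    exact (TwoSidedIdeal.mem_bot A).1 hm
  · rw [dense_iff_closure_eq, ← hI, h]
    rfl

variable (hp : IsStarProjection p) (φ : A ≃⋆ₐ[ℂ] cornerAlgebra p hp)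

/-- The isomorphism `φ` maps `1` to the unit `p` of the corner. -/
theorem coe_corner_one : (φ 1 : Matrix (Fin n) (Fin n) A) = p := by
  let q : cornerAlgebra p hp := ⟨p, hp.isIdempotentElem, hp.isIdempotentElem⟩
  have h : φ 1 * q = q := by
    rw [← φ.apply_symm_apply q, ← map_mul, one_mul]
  have h2 : φ 1 * q = φ 1 := Subtype.ext (φ 1).2.2
  rw [← h2, h]

/-- The left action of `A` on `p Aⁿ` through `φ`. -/
@[reducible]
noncomputable def columnModuleLeft : Module A (columnSpace p) where
  smul a v := ⟨(φ a : Matrix (Fin n) (Fin n) A) *ᵥ (v : Fin n → A), by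
    change p *ᵥ _ = _
    rw [mulVec_mulVec, (φ a).2.1]⟩
  one_smul v := Subtype.ext <| by
    change (φ 1 : Matrix (Fin n) (Fin n) A) *ᵥ (v : Fin n → A) = v
    rw [coe_corner_one, mulVec_coe]
  mul_smul a b v := Subtype.ext <| by
    change (φ (a * b) : Matrix (Fin n) (Fin n) A) *ᵥ (v : Fin n → A) =
      (φ a : Matrix (Fin n) (Fin n) A) *ᵥ ((φ b : Matrix (Fin n) (Fin n) A) *ᵥ (v : Fin n → A))
    rw [mulVec_mulVec, map_mul]
    rfl
  smul_zero a := Subtype.ext (mulVec_zero (φ a : Matrix (Fin n) (Fin n) A))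
  smul_add a v w := Subtype.ext (mulVec_add (φ a : Matrix (Fin n) (Fin n) A) _ _)
  add_smul a b v := Subtype.ext <| by
    change (φ (a + b) : Matrix (Fin n) (Fin n) A) *ᵥ (v : Fin n → A) = _
    rw [map_add]
    exact add_mulVec _ _ _
  zero_smul v := Subtype.ext <| by
    change (φ 0 : Matrix (Fin n) (Fin n) A) *ᵥ (v : Fin n → A) = 0
    rw [map_zero]
    exact zero_mulVec _

theorem coe_columnModuleLeft_smul (a : A) (v : columnSpace p) :
    ((columnModuleLeft hp φ).smul a v : Fin n → A) =
      (φ a : Matrix (Fin n) (Fin n) A) *ᵥ (v : Fin n → A) := rfl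

theorem columns_preL : letI := columnModuleLeft hp φ
    IsPreInner (E := columnSpace p) (fun v w => φ.symm (outer hp v w)) fun v a => star a • v := by
  let := columnModuleLeft hp φ
  refine ⟨fun x y z => ?_, fun x y a => ?_, fun x y => ?_, fun x => ?_⟩
  · rw [← map_add]
    congr 1
    refine Subtype.ext ?_
    change vecMulVec _ (star ((y : Fin n → A) + (z : Fin n → A))) = vecMulVec _ _ + vecMulVec _ _
    rw [star_add, vecMulVec_add]
  · rw [StarAlgEquiv.symm_apply_eq, map_mul, StarAlgEquiv.apply_symm_apply]
    refine Subtype.ext ?_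
    change vecMulVec _ (star ((φ (star a) : Matrix (Fin n) (Fin n) A) *ᵥ (y : Fin n → A))) =
      vecMulVec _ _ * (φ a : Matrix (Fin n) (Fin n) A)
    rw [vecMulVec_mul, star_mulVec, map_star]
    congr 2
    exact conjTranspose_conjTranspose _
  · rw [← map_star]
    congr 1
    refine Subtype.ext ?_
    ext i j
    change star ((x : Fin n → A) j * star ((y : Fin n → A) i)) =
      (y : Fin n → A) i * star ((x : Fin n → A) j)
    rw [star_mul, star_star]
  · rw [star_zero, zero_smul]

theorem columns_innerL_smul (x y z : columnSpace p) :
    (columnModuleLeft hp φ).smul (φ.symm (outer hp x y)) z =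
      x <• (star (y : Fin n → A) ⬝ᵥ (z : Fin n → A)) := by
  refine Subtype.ext ?_
  rw [coe_columnModuleLeft_smul, StarAlgEquiv.apply_symm_apply, coe_outer, vecMulVec_mulVec]
  rfl

variable [PartialOrder A] [StarOrderedRing A]

theorem columns_innerR_self_nonneg (v : columnSpace p) :
    0 ≤ star (v : Fin n → A) ⬝ᵥ (v : Fin n → A) :=
  Finset.sum_nonneg fun _ _ => star_mul_self_nonneg _

/-- Finitely many columns with `∑ ⟪ζᵢ, ζᵢ⟫ᵣ = 1` are a basis for the left inner product. -/
theorem columns_exists_left_frame (hA : IsSimpleCStarAlgebra A) (h0 : p ≠ 0) :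
    letI := columnModuleLeft hp φ
    ∃ (m : ℕ) (ζ : Fin m → columnSpace p),
      ∀ v, v = ∑ i, star (φ.symm (outer hp (ζ i) v)) • ζ i := by
  let := columnModuleLeft hp φ
  obtain ⟨m, ζ, hζ⟩ := columns_preR.exists_sum_eq_one columns_innerR_self_nonneg
    (columns_full hA hp h0)
  refine ⟨m, ζ, fun v => ?_⟩
  have h : ∀ i, star (φ.symm (outer hp (ζ i) v)) • ζ i =
      v <• (star (ζ i : Fin n → A) ⬝ᵥ (ζ i : Fin n → A)) := by
    intro i
    rw [(columns_preL hp φ).star_form]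
    exact columns_innerL_smul hp φ v (ζ i) (ζ i)
  simp only [h]
  rw [← Finset.sum_smul, ← Finset.op_sum, hζ, MulOpposite.op_one, one_smul]

/-- The bimodule `p Aⁿ` of a projection `p ≠ 0` and an isomorphism `φ : A ≅ p Mₙ(A) p`, with
`a v = φ(a) v`, `⟪v, w⟫ₗ = φ⁻¹(v w⋆)` and `⟪v, w⟫ᵣ = v⋆ w`. -/
noncomputable def ofCorner (hA : IsSimpleCStarAlgebra A) (h0 : p ≠ 0) : EquivalenceBimodule A :=
  letI := columnModuleLeft hp φ
  { carrier := columnSpace p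
    towerLeft := ⟨fun c a v => Subtype.ext <| by
      change (φ (c • a) : Matrix (Fin n) (Fin n) A) *ᵥ (v : Fin n → A) =
        c • ((φ a : Matrix (Fin n) (Fin n) A) *ᵥ (v : Fin n → A))
      rw [map_smul, ← smul_mulVec]
      rfl⟩
    towerRight := ⟨fun c a v => Subtype.ext (smul_assoc c a (v : Fin n → A))⟩
    smulComm := ⟨fun a b v => Subtype.ext (mulVec_smul (φ a : Matrix (Fin n) (Fin n) A) b _)⟩
    innerL v w := φ.symm (outer hp v w)
    innerR v w := star (v : Fin n → A) ⬝ᵥ (w : Fin n → A)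
    innerL_add_left := (columns_preL hp φ).add_left
    innerL_smul_left a x y := by simpa using (columns_preL hp φ).act_left x y (star a)
    star_innerL := (columns_preL hp φ).star_form
    innerL_self_nonneg := by
      obtain ⟨m, ζ, hζ⟩ := columns_exists_left_frame hp φ hA h0
      exact (columns_preL hp φ).nonneg_of_frame hζ
    innerL_definite := by
      obtain ⟨m, ζ, hζ⟩ := columns_exists_left_frame hp φ hA h0
      exact (columns_preL hp φ).definite_of_frame hζ
    innerL_complete := by
      obtain ⟨m, ζ, hζ⟩ := columns_exists_left_frame hp φ hA h0
      exact (columns_preL hp φ).complete_of_frame hζ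
    innerL_full := by
      refine full_of_sum_eq_one (columns_preL hp φ) (projColumn hp) ?_
      rw [← map_sum, StarAlgEquiv.symm_apply_eq]
      exact Subtype.ext ((sum_outer_projColumn hp).trans (coe_corner_one hp φ).symm)
    innerR_add_right := columns_preR.add_right
    innerR_smul_right := columns_preR.act_right
    star_innerR := columns_preR.star_form
    innerR_self_nonneg := columns_innerR_self_nonneg
    innerR_definite := columns_preR.definite_of_frame (projColumn_frame hp)
    innerR_complete := columns_preR.complete_of_frame (projColumn_frame hp)
    innerR_full := columns_full hA hp h0
    innerL_smul := columns_innerL_smul hp φ }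

theorem ofCorner_isFiniteBasis (hA : IsSimpleCStarAlgebra A) (h0 : p ≠ 0) :
    (ofCorner hp φ hA h0).IsFiniteBasis (projColumn hp) := projColumn_frame hp

theorem ofCorner_innerR_projColumn (hA : IsSimpleCStarAlgebra A) (h0 : p ≠ 0) (i : Fin n) :
    (ofCorner hp φ hA h0).innerR (projColumn hp i) (projColumn hp i) = p i i :=
  star_projColumn_dotProduct hp i _

end columns

end EquivalenceBimodule

/-! ### The image of `T` -/

section image

open EquivalenceBimodule

variable {A : Type u} [CStarAlgebra A] [PartialOrder A] [StarOrderedRing A] {τ : A →ₚ[ℂ] ℂ}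

theorem range_traceHom (hA : IsSimpleCStarAlgebra A) (hτ : IsUniqueTrace τ) :
    ((traceHom τ hτ).range : Set {t : ℝ // 0 < t}) = fundamentalGroup τ := by
  ext t
  constructor
  · rintro ⟨x, rfl⟩
    obtain ⟨E, rfl⟩ := Pic.mk_surjective x
    obtain ⟨n, ξ, hξ⟩ := E.exists_finiteBasis
    exact ⟨n, gram ξ, hξ.isStarProjection_gram,
      ⟨StarAlgEquiv.ofBijective (cornerHom hξ) ⟨cornerHom_injective hξ, cornerHom_surjective hξ⟩⟩,
      (traceHom_mk τ hτ E hξ).symm⟩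
  · rintro ⟨n, p, hp, ⟨φ⟩, ht⟩
    have h0 : p ≠ 0 := by
      rintro rfl
      have := t.2
      simp [eq_comm] at ht
      exact this.ne' ht
    refine ⟨Pic.mk (ofCorner hp φ hA h0), Subtype.ext (Complex.ofReal_injective ?_)⟩
    rw [traceHom_mk τ hτ _ (ofCorner_isFiniteBasis hp φ hA h0), ← ht]
    simp only [ofCorner_innerR_projColumn]

end image

theorem mainTheorem8 {A : Type u} [CStarAlgebra A] [PartialOrder A] [StarOrderedRing A]
    (hA : IsSimpleCStarAlgebra A) (τ : A →ₚ[ℂ] ℂ) (hτ : IsUniqueTrace τ)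
    (hsep : SeparatesProjections τ) :
    Function.Injective (rho A) ∧ (rho A).range = (traceHom τ hτ).ker ∧
      ((traceHom τ hτ).range : Set {t : ℝ // 0 < t}) = fundamentalGroup τ :=
  ⟨rho_injective, range_rho hτ hsep, range_traceHom hA hτ⟩
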